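/- All graphs are finite and may have loops and parallel edges. A *snark* is a connected cubic graph (a loop contributes 2 to the degree of its vertex) that has no proper edge-colouring with three colours (the two ends of a loop meet at its vertex, so a graph with a loop has no such colouring). For distinct vertices $u,v$ of a graph $G$, let $G-\{u,v\}$ be the graph obtained by removing $u$ and $v$ but retaining the dangling edges, and let $G/\{u,v\}$ be the graph obtained by identifying $u$ and $v$. For an edge $e$ that is not a loop of a cubic graph $G$, let $G\sim e$ be the graph obtained from $G-e$ by suppressing the two resulting vertices of degree two (a vertexless circle arising in this way is discarded). A snark $G$ is *critical* if $G-\{u,v\}$ is 3-edge-colourable for every pair of distinct adjacent vertices $u,v$. It is *4-edge-critical* if $G$ has no nowhere-zero 4-flow, but $G/\{u,v\}$ has a nowhere-zero 4-flow for every pair of distinct adjacent vertices $u,v$. It is *$k$-irreducible* if the removal of fewer than $k$ edges from $G$ never produces a component that is not 3-edge-colourable and can be completed, by adding vertices and edges, to a cubic graph of order smaller than that of $G$. **Theorem.** For every snark $G$ the following statements are equivalent: 1. $G$ is critical; 2. $G$ is 4-edge-critical; 3. $G$ is 5-irreducible; 4. $G$ is 6-irreducible; 5. $G\sim e$ is 3-edge-colourable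 for every edge $e$ of $G$ that is not a loop. -/

import Mathlib

open scoped Graph

namespace Graph

variable {α β : Type*}

/-! ### Cubic graphs, edge-colourings, snarks

Graphs are Mathlib multigraphs `Graph α β`: loops and parallel edges are allowed. -/

/-- The degree of `x`: the number of edges incident with `x`, each loop being counted twice. -/
noncomputable def degree (G : Graph α β) (x : α) : ℕ∞ :=
  (G.incidenceSet x).encard + (G.loopSet x).encard

/-- A finite graph all of whose vertices have degree three. -/
def IsCubic (G : Graph α β) : Prop :=
  V(G).Finite ∧ ∀ x ∈ V(G), G.degree x = 3

/-- The order of a graph: its number of vertices. -/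
noncomputable def order (G : Graph α β) : ℕ := V(G).ncard

/-- A nonempty graph any two of whose vertices are joined by a walk. -/
def IsConnected (G : Graph α β) : Prop :=
  V(G).Nonempty ∧ ∀ x ∈ V(G), ∀ y ∈ V(G), Relation.ReflTransGen G.Adj x y

/-- `G` has a proper edge-colouring with three colours: edges that meet at a vertex get different
colours. The two ends of a loop meet at its vertex, so a graph with a loop has no such colouring. -/
def IsThreeEdgeColourable (G : Graph α β) : Prop :=
  (∀ e x, ¬ G.IsLoopAt e x) ∧
    ∃ c : β → Fin 3, ∀ x e f, G.Inc e x → G.Inc f x → e ≠ f → c e ≠ c f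

/-- A snark: a connected cubic graph without a proper edge-colouring with three colours. -/
def IsSnark (G : Graph α β) : Prop :=
  G.IsConnected ∧ G.IsCubic ∧ ¬ G.IsThreeEdgeColourable

/-! ### Removal of vertices with dangling edges retained -/

open Classical in
/-- The end at `x` of the edge `e` after the vertices in `X` are removed: it stays at `x` if `x`
survives, and otherwise it becomes a free end `Sum.inr e`, private to `e`. -/
noncomputable def endAfter (X : Set α) (e : β) (x : α) : α ⊕ β :=
  if x ∈ X then Sum.inr e else Sum.inl x

/-- The graph obtained from `G` by removing the vertices in `X` but retaining the dangling edges.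
An edge with exactly one end in `X` is kept and dangles: its other end is the free end `Sum.inr e`,
which is incident with no other edge. An edge with all its ends in `X` is removed. -/
noncomputable def removeVerts (G : Graph α β) (X : Set α) : Graph (α ⊕ β) β where
  vertexSet := Sum.inl '' (V(G) \ X) ∪
    Sum.inr '' {e | ∃ x y, G.IsLink e x y ∧ x ∉ X ∧ y ∈ X}
  IsLink e a b := ∃ x y, G.IsLink e x y ∧ (x ∉ X ∨ y ∉ X) ∧
    a = endAfter X e x ∧ b = endAfter X e y
  isLink_symm := by
    rintro e -
    refine ⟨?_⟩
    rintro a b ⟨x, y, h, hX, rfl, rfl⟩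
    exact ⟨y, x, h.symm, hX.symm, rfl, rfl⟩
  eq_or_eq_of_isLink_of_isLink := by
    rintro e a b c d ⟨x, y, h, -, rfl, rfl⟩ ⟨z, w, h', -, rfl, rfl⟩
    rcases h.left_eq_or_eq h' with rfl | rfl
    · exact Or.inl rfl
    · exact Or.inr rfl
  left_mem_of_isLink := by
    rintro e a b ⟨x, y, h, hX, rfl, rfl⟩
    by_cases hx : x ∈ X
    · right
      exact ⟨e, ⟨y, x, h.symm, by tauto, hx⟩, by simp [endAfter, hx]⟩
    · left
      exact ⟨x, ⟨h.left_mem, hx⟩, by simp [endAfter, hx]⟩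

/-- `G` is critical: `G - {u, v}` is 3-edge-colourable for any two adjacent vertices `u`, `v`. -/
def IsCritical (G : Graph α β) : Prop :=
  ∀ u v, u ≠ v → G.Adj u v → (G.removeVerts {u, v}).IsThreeEdgeColourable

/-! ### Nowhere-zero flows -/

/-- The finite graph `G` has a nowhere-zero `k`-flow: for some orientation, every edge `e` directed
from `tail e` to `head e`, there are integers `φ e` with `0 < |φ e| < k` such that at each vertex
the outgoing and the incoming values have the same sum. -/
def HasNowhereZeroFlow (G : Graph α β) (k : ℕ) : Prop :=
  ∃ (tail head : β → α) (φ : β → ℤ),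
    (∀ e ∈ E(G), G.IsLink e (tail e) (head e) ∧ φ e ≠ 0 ∧ |φ e| < (k : ℤ)) ∧
    ∀ x ∈ V(G), ∑ᶠ e ∈ {e | e ∈ E(G) ∧ tail e = x}, φ e = ∑ᶠ e ∈ {e | e ∈ E(G) ∧ head e = x}, φ e

open Classical in
/-- The graph `G / {u, v}` obtained from `G` by identifying `u` and `v`. All edges are kept, and
those joining `u` and `v` become loops. -/
noncomputable def identify (G : Graph α β) (u v : α) : Graph α β :=
  G.map (fun x => if x = v then u else x)

/-- `G` is `k`-edge-critical: it has no nowhere-zero `k`-flow, but `G / {u, v}` has one for any two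
adjacent vertices `u`, `v`. -/
def IsEdgeCritical (G : Graph α β) (k : ℕ) : Prop :=
  ¬ G.HasNowhereZeroFlow k ∧
    ∀ u v, u ≠ v → G.Adj u v → (G.identify u v).HasNowhereZeroFlow k

/-! ### Irreducibility -/

/-- `C` is a connected component of `G`. -/
def IsComponentOf (C G : Graph α β) : Prop :=
  C.IsClosedSubgraph G ∧ C.IsConnected

/-- `H` contains `C`, vertices and edges of `C` being labelled in `H` by `Sum.inl`. The labels
`Sum.inr n` are a supply of arbitrarily many further vertices and edges. -/
def Completes (H : Graph (α ⊕ ℕ) (β ⊕ ℕ)) (C : Graph α β) : Prop :=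
  (∀ x ∈ V(C), Sum.inl x ∈ V(H)) ∧
    ∀ e x y, C.IsLink e x y → H.IsLink (Sum.inl e) (Sum.inl x) (Sum.inl y)

/-- `G` is `k`-irreducible: removing fewer than `k` edges never produces a component that is not
3-edge-colourable and can be completed to a cubic graph of order smaller than that of `G`. -/
def IsIrreducible (G : Graph α β) (k : ℕ) : Prop :=
  ∀ S ⊆ E(G), S.encard < k → ∀ C : Graph α β, C.IsComponentOf (G.deleteEdges S) →
    ¬ C.IsThreeEdgeColourable →
    ¬ ∃ H : Graph (α ⊕ ℕ) (β ⊕ ℕ), H.Completes C ∧ H.IsCubic ∧ H.order < G.order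

/-! ### Suppression of vertices of degree two -/

/-- `G.IsThread S x l y`: the edges in the list `l` form a walk in `G` from `x` to `y` without
repeated edges, and all its inner vertices lie in `S`. -/
inductive IsThread (G : Graph α β) (S : Set α) : α → List β → α → Prop
  | single {f : β} {x y : α} : G.IsLink f x y → IsThread G S x [f] y
  | cons {f : β} {l : List β} {x w y : α} : G.IsLink f x w → w ∈ S → f ∉ l →
      IsThread G S w l y → IsThread G S x (f :: l) y

theorem IsThread.concat {G : Graph α β} {S : Set α} {x w y : α} {l : List β} {f : β}
    (h : G.IsThread S x l w) (hw : w ∈ S) (hf : f ∉ l) (hl : G.IsLink f w y) :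
    G.IsThread S x (l ++ [f]) y := by
  induction h with
  | single h => exact .cons h hw (by simpa [eq_comm] using hf) (.single hl)
  | cons h h1 h2 _ ih =>
    simp only [List.mem_cons, not_or] at hf
    exact .cons h h1 (by simp [h2, Ne.symm hf.1]) (ih hw hf.2 hl)

theorem IsThread.reverse {G : Graph α β} {S : Set α} {x y : α} {l : List β}
    (h : G.IsThread S x l y) : G.IsThread S y l.reverse x := by
  induction h with
  | single h => exact .single h.symm
  | cons h h1 h2 _ ih =>
    rw [List.reverse_cons]
    exact ih.concat h1 (by simpa using h2) h.symm

theorem IsThread.exists_inc {G : Graph α β} {S : Set α} {x y : α} {l : List β}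
    (h : G.IsThread S x l y) : ∃ f ∈ l, G.Inc f x := by
  cases h with
  | single h => exact ⟨_, by simp, h.inc_left⟩
  | cons h _ _ _ => exact ⟨_, by simp, h.inc_left⟩

theorem IsThread.eq_or_eq {G : Graph α β} {S : Set α} {x y z : α} {l : List β} {f : β}
    (h : G.IsThread S x l y) (hf : f ∈ l) (hz : G.Inc f z) (hS : z ∉ S) : z = x ∨ z = y := by
  induction h with
  | single h =>
    rw [List.mem_singleton] at hf
    subst hf
    exact hz.eq_or_eq_of_isLink h
  | cons h h1 _ _ ih =>
    rcases List.mem_cons.1 hf with rfl | hf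
    · rcases hz.eq_or_eq_of_isLink h with rfl | rfl
      · exact Or.inl rfl
      · exact absurd h1 hS
    · rcases ih hf with rfl | h
      · exact absurd h1 hS
      · exact Or.inr h

/-- The graph obtained from `G` by suppressing all vertices in `S`, which are meant to have degree
two. Its vertices are those of `G` outside `S`, and each thread of `G` through vertices in `S` that
joins two such vertices becomes a single edge, labelled by the set of edges of the thread.
A component of `G` that is a cycle with all its vertices in `S` disappears. -/
def suppress (G : Graph α β) (S : Set α) : Graph α (Set β) where
  vertexSet := V(G) \ S
  IsLink F x y := x ∉ S ∧ y ∉ S ∧ ∃ l, G.IsThread S x l y ∧ {f | f ∈ l} = F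
  isLink_symm := by
    rintro F -
    refine ⟨?_⟩
    rintro x y ⟨hx, hy, l, hl, rfl⟩
    exact ⟨hy, hx, l.reverse, hl.reverse, by simp⟩
  eq_or_eq_of_isLink_of_isLink := by
    rintro F x y v w ⟨hx, -, l, hl, rfl⟩ ⟨-, -, l', hl', hF⟩
    obtain ⟨f, hf, hi⟩ := hl.exists_inc
    have hf' : f ∈ {f | f ∈ l'} := by rw [hF]; exact hf
    exact hl'.eq_or_eq hf' hi hx
  left_mem_of_isLink := by
    rintro F x y ⟨hx, -, l, hl, -⟩
    obtain ⟨f, -, hi⟩ := hl.exists_inc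
    exact ⟨hi.vertex_mem, hx⟩

/-- The graph `G ∼ e` for an edge `e` that is not a loop of the cubic graph `G`: remove `e` and
suppress its two ends, which have degree two in `G - e`. -/
def deleteSuppress (G : Graph α β) (e : β) : Graph α (Set β) :=
  (G.deleteEdges {e}).suppress {x | G.Inc e x}

end Graph

/-! Everything is translated into assignments of nonzero elements of the Klein group to the edges.
Three nonzero elements sum to zero exactly when they are distinct, and a loop contributes nothing to
the sum at its vertex. So in a cubic graph proper colourings are nowhere-zero Klein flows, and `G -
{u, v}` is colourable iff some assignment satisfies Kirchhoff's law outside `{u, v}`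
(`removeVerts_colourable_iff`). Each edge has two ends, so all net sums add up to zero, and the
defects at `u` and `v` are equal (`IsEnds.netSum_add_eq_zero`).

1 ⇔ 2: equal defects cancel when `u` and `v` are identified, so these assignments are the Klein
flows of `G / {u, v}`; Klein flows and 4-flows exist together (`exists_klein_flow_iff`).

1 ⇔ 5: let `e` join `u` and `v`. If the two other edges at an end of `e` had different values,
giving `e` their sum would produce a flow on the snark. So values are constant along the threads
that suppression contracts, and the colouring descends. Conversely, a colouring of `G ∼ e` lifts
along threads.

1 ⇒ 4: a forbidden component `C` misses at least two vertices, since cubic graphs have even order.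
Criticality makes the missed vertices independent and loopless, so the three edges at each of them
were all removed: at least six edges. 4 ⇒ 3 is monotonicity.

3 ⇒ 1: at most four edges join `{u, v}` to the rest. An uncolourable component of the rest has at
most `n - 2` vertices, where `n` is the order of `G`, and needs at most one more to become cubic
(`exists_cubic_completion`). So every such component is colourable, and the colourings extend to the
dangling edges. -/

namespace Graph

variable {α β : Type*}

/-! ### Eulerian orientations; Klein flows and integer 4-flows -/

section Balance

open Classical in
/-- The sum at `x` of the values of `c` over the edges in `E`, where the edge `e` has the ends
`t e` and `h e` and counts once for each end equal to `x`. -/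
noncomputable def netSum {A : Type*} [AddCommMonoid A] (E : Finset β) (t h : β → α) (c : β → A)
    (x : α) : A :=
  ∑ e ∈ E, ((if t e = x then c e else 0) + if h e = x then c e else 0)

open Classical in
/-- The contribution at `x` of an edge directed from `t e` to `h e`. -/
noncomputable def dirInd (t h : β → α) (e : β) (x : α) : ℤ :=
  (if t e = x then 1 else 0) - if h e = x then 1 else 0

lemma abs_dirInd_le (t h : β → α) (e : β) (x : α) : |dirInd t h e x| ≤ 1 := by
  unfold dirInd; split_ifs <;> simp

-- Traversed one after the other, two edges with a common end act like a single edge from `b` to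
-- `c`, because their contributions at the common end cancel. The signs say whether each is
-- traversed along or against its direction.
open Classical in
lemma exists_splice {t h : β → α} {e f : β} (hs : t e = t f ∨ t e = h f ∨ h e = t f ∨ h e = h f) :
    ∃ (b c : α) (ε δ : ℤ), (ε = 1 ∨ ε = -1) ∧ (δ = 1 ∨ δ = -1) ∧
      ∀ x, ε * dirInd t h e x + δ * dirInd t h f x =
        (if b = x then 1 else 0) - if c = x then 1 else 0 := by
  unfold dirInd
  rcases hs with hs | hs | hs | hs
  · exact ⟨h e, h f, -1, 1, by simp, by simp, fun x => by rw [hs]; ring⟩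
  · exact ⟨h e, t f, -1, -1, by simp, by simp, fun x => by rw [hs]; ring⟩
  · exact ⟨t e, h f, 1, 1, by simp, by simp, fun x => by rw [hs]; ring⟩
  · exact ⟨t e, t f, 1, -1, by simp, by simp, fun x => by rw [hs]; ring⟩

/-- Any finite family of edges can be reoriented so that at every vertex the numbers of outgoing
and incoming edges differ by at most one. -/
lemma exists_balanced (E : Finset β) : ∀ t h : β → α, ∃ ψ : β → ℤ,
    (∀ e ∈ E, ψ e = 1 ∨ ψ e = -1) ∧ ∀ x, |∑ e ∈ E, ψ e * dirInd t h e x| ≤ 1 := by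
  classical
  induction E using Finset.strongInduction with
  | H E ih =>
  intro t h
  by_cases hl : ∃ e ∈ E, t e = h e
  · obtain ⟨e, he, hte⟩ := hl
    obtain ⟨ψ, h1, h2⟩ := ih _ (Finset.erase_ssubset he) t h
    refine ⟨Function.update ψ e 1, fun g hg => ?_, fun x => ?_⟩
    · by_cases hge : g = e
      · simp [hge]
      · simpa [hge] using h1 g (Finset.mem_erase.2 ⟨hge, hg⟩)
    · rw [← Finset.add_sum_erase _ _ he]
      have : dirInd t h e x = 0 := by simp [dirInd, hte]
      rw [this, mul_zero, zero_add]
      convert h2 x using 2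
      refine Finset.sum_congr rfl fun g hg => ?_
      rw [Function.update_of_ne (Finset.ne_of_mem_erase hg)]
  -- Two edges that meet are spliced into one edge, which keeps the name `e` while `f` is dropped;
  -- its sign is handed back to both through `ε` and `δ`.
  by_cases hs : ∃ e ∈ E, ∃ f ∈ E, e ≠ f ∧ (t e = t f ∨ t e = h f ∨ h e = t f ∨ h e = h f)
  · obtain ⟨e, he, f, hf, hef, hs⟩ := hs
    obtain ⟨b, c, ε, δ, hε, hδ, hD⟩ := exists_splice hs
    obtain ⟨ψ, h1, h2⟩ := ih _ (Finset.erase_ssubset hf) (Function.update t e b)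
      (Function.update h e c)
    have heE : e ∈ E.erase f := Finset.mem_erase.2 ⟨hef, he⟩
    refine ⟨Function.update (Function.update ψ e (ψ e * ε)) f (ψ e * δ), fun g hg => ?_,
      fun x => ?_⟩
    · by_cases hgf : g = f
      · subst hgf
        rcases h1 e heE with h | h <;> rcases hδ with h' | h' <;> simp [h, h']
      by_cases hge : g = e
      · subst hge
        rcases h1 g heE with h | h <;> rcases hε with h' | h' <;> simp [h, h', hgf]
      · simpa [hgf, hge] using h1 g (Finset.mem_erase.2 ⟨hgf, hg⟩)
    · have key := h2 x
      rw [← Finset.add_sum_erase _ _ heE] at key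
      rw [← Finset.add_sum_erase _ _ hf, ← Finset.add_sum_erase _ _ heE]
      convert key using 2
      rw [← add_assoc]
      congr 1
      · have h3 : dirInd (Function.update t e b) (Function.update h e c) e x =
          (if b = x then 1 else 0) - if c = x then 1 else 0 := by simp [dirInd]
        rw [h3, ← hD]
        simp only [Function.update_self, Function.update_of_ne hef]
        ring
      · refine Finset.sum_congr rfl fun g hg => ?_
        have hge := Finset.ne_of_mem_erase hg
        have hgf := Finset.ne_of_mem_erase (Finset.mem_of_mem_erase hg)
        simp [dirInd, Function.update_of_ne, hge, hgf]
  -- What remains is a matching, and any orientation of it is balanced.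
  · push Not at hl hs
    refine ⟨fun _ => 1, fun _ _ => Or.inl rfl, fun x => ?_⟩
    simp only [one_mul]
    by_cases hx : ∃ e ∈ E, t e = x ∨ h e = x
    · obtain ⟨e, he, hx⟩ := hx
      rw [Finset.sum_eq_single_of_mem e he]
      · exact abs_dirInd_le ..
      · intro g hg hge
        have := hs e he g hg hge.symm
        unfold dirInd
        rcases hx with rfl | rfl
        · simp [Ne.symm this.1, Ne.symm this.2.1]
        · simp [Ne.symm this.2.2.1, Ne.symm this.2.2.2]
    · push Not at hx
      rw [Finset.sum_eq_zero]
      · simp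
      · intro g hg
        simp [dirInd, hx g hg]

/-- A finite family of edges all of whose degrees are even has an Eulerian orientation. -/
lemma exists_eulerian (E : Finset β) (t h : β → α)
    (hE : ∀ x, netSum E t h (fun _ => (1 : ZMod 2)) x = 0) : ∃ ψ : β → ℤ,
    (∀ e ∈ E, ψ e = 1 ∨ ψ e = -1) ∧ ∀ x, ∑ e ∈ E, ψ e * dirInd t h e x = 0 := by
  obtain ⟨ψ, h1, h2⟩ := exists_balanced E t h
  refine ⟨ψ, h1, fun x => ?_⟩
  -- Signs vanish modulo 2, so the imbalance is even; being at most one in absolute value, it is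
  -- zero.
  have h3 : ((∑ e ∈ E, ψ e * dirInd t h e x : ℤ) : ZMod 2) = 0 := by
    rw [← hE x, netSum, Int.cast_sum]
    refine Finset.sum_congr rfl fun e he => ?_
    rcases h1 e he with h | h <;> rw [h] <;> unfold dirInd <;> split_ifs <;> simp <;> decide
  have h4 := (ZMod.intCast_zmod_eq_zero_iff_dvd _ 2).1 h3
  have h5 := abs_le.1 (h2 x)
  norm_num at h4
  omega

/-- The Klein four-group, written additively. -/
abbrev Klein := ZMod 2 × ZMod 2

lemma netSum_zmod_filter (E : Finset β) (t h : β → α) (c : β → ZMod 2) (x : α) :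
    netSum (E.filter fun e => c e ≠ 0) t h (fun _ => (1 : ZMod 2)) x = netSum E t h c x := by
  classical
  unfold netSum
  rw [Finset.sum_filter]
  refine Finset.sum_congr rfl fun e _ => ?_
  have : c e = 0 ∨ c e = 1 := by generalize c e = a; revert a; decide
  rcases this with h | h <;> simp [h]

lemma netSum_map {A B : Type*} [AddCommMonoid A] [AddCommMonoid B] (f : A →+ B) (E : Finset β)
    (t h : β → α) (c : β → A) (x : α) :
    netSum E t h (fun e => f (c e)) x = f (netSum E t h c x) := by
  simp [netSum, map_sum, apply_ite f]

lemma netSum_intCast (E : Finset β) (t h : β → α) (c : β → ℤ) (x : α) :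
    netSum E t h (fun e => (c e : ZMod 2)) x = ((∑ e ∈ E, c e * dirInd t h e x : ℤ) : ZMod 2) := by
  rw [netSum, Int.cast_sum]
  refine Finset.sum_congr rfl fun e he => ?_
  have h2 : ∀ a : ZMod 2, -a = a := by decide
  unfold dirInd
  split_ifs <;> simp [h2]
  exact CharTwo.add_self_eq_zero _

/-- Klein flows and integer flows: a nowhere-zero flow with values in the Klein four-group exists
if and only if a nowhere-zero 4-flow does. -/
lemma exists_klein_flow_iff (E : Finset β) (t h : β → α) :
    (∃ c : β → Klein, (∀ e ∈ E, c e ≠ 0) ∧ ∀ x, netSum E t h c x = 0) ↔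
    ∃ φ : β → ℤ, (∀ e ∈ E, φ e ≠ 0 ∧ |φ e| < 4) ∧ ∀ x, ∑ e ∈ E, φ e * dirInd t h e x = 0 := by
  classical
  constructor
  -- The support of each coordinate has even degrees. With Eulerian orientations `ψ₁`, `ψ₂` of the
  -- two supports, `2ψ₁ + ψ₂` is a flow that vanishes only where both coordinates do.
  · rintro ⟨c, hc, hx⟩
    obtain ⟨ψ₁, h1, h1'⟩ := exists_eulerian (E.filter fun e => (c e).1 ≠ 0) t h fun x => by
      rw [netSum_zmod_filter E t h (fun e => (c e).1)]
      have := netSum_map (AddMonoidHom.fst (ZMod 2) (ZMod 2)) E t h c x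
      simpa [hx x] using this
    obtain ⟨ψ₂, h2, h2'⟩ := exists_eulerian (E.filter fun e => (c e).2 ≠ 0) t h fun x => by
      rw [netSum_zmod_filter E t h (fun e => (c e).2)]
      have := netSum_map (AddMonoidHom.snd (ZMod 2) (ZMod 2)) E t h c x
      simpa [hx x] using this
    refine ⟨fun e => 2 * (if (c e).1 ≠ 0 then ψ₁ e else 0) + if (c e).2 ≠ 0 then ψ₂ e else 0,
      fun e he => ?_, fun x => ?_⟩
    · have h0 : ¬ ((c e).1 = 0 ∧ (c e).2 = 0) := fun h => hc e he (Prod.ext h.1 h.2)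
      have h1 := h1 e
      have h2 := h2 e
      simp only [Finset.mem_filter, he, true_and] at h1 h2
      by_cases ha : (c e).1 = 0 <;> by_cases hb : (c e).2 = 0
      · exact absurd ⟨ha, hb⟩ h0
      · rcases h2 hb with h | h <;> simp [ha, hb, h]
      · rcases h1 ha with h | h <;> simp [ha, hb, h]
      · rcases h1 ha with h | h <;> rcases h2 hb with h' | h' <;> simp [ha, hb, h, h']
    · have h1' := h1' x
      have h2' := h2' x
      rw [Finset.sum_filter] at h1' h2'
      have : ∀ e, (2 * (if (c e).1 ≠ 0 then ψ₁ e else 0) + if (c e).2 ≠ 0 then ψ₂ e else 0) *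
          dirInd t h e x = 2 * (if (c e).1 ≠ 0 then ψ₁ e * dirInd t h e x else 0) +
          if (c e).2 ≠ 0 then ψ₂ e * dirInd t h e x else 0 := by
        intro e; split_ifs <;> ring
      simp only [this]
      rw [Finset.sum_add_distrib, ← Finset.mul_sum, h1', h2']
      rfl
  · rintro ⟨φ, hφ, hx⟩
    -- Adding an Eulerian orientation of the odd edges makes every value even, so half the sum is an
    -- integer flow. The Klein flow is the pair of `φ` and this half, modulo 2. Where `φ` is even it
    -- is `±2`, so the half is `±1` and the second coordinate is nonzero.
    obtain ⟨ψ, h1, h1'⟩ := exists_eulerian (E.filter fun e => (φ e : ZMod 2) ≠ 0) t h fun x => by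
      rw [netSum_zmod_filter E t h (fun e => (φ e : ZMod 2)), netSum_intCast, hx, Int.cast_zero]
    have hpar : ∀ e, (φ e : ZMod 2) = 0 ↔ φ e % 2 = 0 := fun e => by
      rw [ZMod.intCast_zmod_eq_zero_iff_dvd]; norm_num
    set ψ' : β → ℤ := fun e => if (φ e : ZMod 2) ≠ 0 then ψ e else 0 with hψ'
    have hval : ∀ e ∈ E, 2 * ((φ e + ψ' e) / 2) = φ e + ψ' e ∧
        (φ e % 2 = 0 → (φ e + ψ' e) / 2 = 1 ∨ (φ e + ψ' e) / 2 = -1) := by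
      intro e he
      have hh := h1 e
      simp only [Finset.mem_filter, he, true_and, ne_eq, hpar] at hh
      have h3 := (hφ e he).1
      have h4 := abs_lt.1 (hφ e he).2
      simp only [hψ', ne_eq, hpar]
      split_ifs with h5
      · omega
      · have := hh h5; omega
    refine ⟨fun e => ((φ e : ZMod 2), (((φ e + ψ' e) / 2 : ℤ) : ZMod 2)), fun e he h0 => ?_,
      fun x => ?_⟩
    · have ha := congrArg Prod.fst h0
      have hb := congrArg Prod.snd h0
      simp only [Prod.fst_zero, Prod.snd_zero] at ha hb
      rcases (hval e he).2 ((hpar e).1 ha) with h | h <;> rw [h] at hb <;> revert hb <;> decide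
    · have ha := netSum_map (AddMonoidHom.fst (ZMod 2) (ZMod 2)) E t h
        (fun e => ((φ e : ZMod 2), (((φ e + ψ' e) / 2 : ℤ) : ZMod 2))) x
      have hb := netSum_map (AddMonoidHom.snd (ZMod 2) (ZMod 2)) E t h
        (fun e => ((φ e : ZMod 2), (((φ e + ψ' e) / 2 : ℤ) : ZMod 2))) x
      simp only [AddMonoidHom.coe_fst, AddMonoidHom.coe_snd] at ha hb
      refine Prod.ext ?_ ?_
      · rw [← ha, netSum_intCast, hx]; rfl
      · rw [← hb, netSum_intCast]
        have h5 : 2 * ∑ e ∈ E, (φ e + ψ' e) / 2 * dirInd t h e x = 0 := by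
          have h6 : ∑ e ∈ E, ψ' e * dirInd t h e x = 0 := by
            rw [← h1' x, Finset.sum_filter]
            refine Finset.sum_congr rfl fun e _ => ?_
            simp only [hψ']
            split_ifs <;> simp
          calc _ = ∑ e ∈ E, (φ e * dirInd t h e x + ψ' e * dirInd t h e x) := by
                rw [Finset.mul_sum]
                refine Finset.sum_congr rfl fun e he => ?_
                rw [← mul_assoc, (hval e he).1, add_mul]
            _ = 0 := by rw [Finset.sum_add_distrib, hx, h6, add_zero]
        have h7 : ∑ e ∈ E, (φ e + ψ' e) / 2 * dirInd t h e x = 0 := by omega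
        rw [h7]; rfl

end Balance

/-! ### Independence of the chosen ends -/

section Ends

/-- `t e` and `h e` are the ends of each edge `e`. -/
def IsEnds (G : Graph α β) (t h : β → α) : Prop := ∀ e ∈ E(G), G.IsLink e (t e) (h e)

lemma exists_isEnds [Nonempty α] (G : Graph α β) : ∃ t h, G.IsEnds t h := by
  have : ∀ e, ∃ p : α × α, e ∈ E(G) → G.IsLink e p.1 p.2 := fun e => by
    by_cases he : e ∈ E(G)
    · obtain ⟨x, y, h⟩ := exists_isLink_of_mem_edgeSet he
      exact ⟨(x, y), fun _ => h⟩
    · exact ⟨Classical.arbitrary _, fun h => absurd h he⟩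
  choose p hp using this
  exact ⟨fun e => (p e).1, fun e => (p e).2, fun e he => hp e he⟩

lemma IsEnds.netSum_congr {A : Type*} [AddCommMonoid A] {G : Graph α β} {t h t' h' : β → α}
    (hG : G.IsEnds t h) (hG' : G.IsEnds t' h') {E : Finset β} (hE : ↑E ⊆ E(G)) (c : β → A) (x : α) :
    netSum E t h c x = netSum E t' h' c x := by
  refine Finset.sum_congr rfl fun e he => ?_
  rcases (hG e (hE he)).eq_and_eq_or_eq_and_eq (hG' e (hE he)) with ⟨h1, h2⟩ | ⟨h1, h2⟩
  · rw [h1, h2]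
  · rw [h1, h2, add_comm]

lemma IsEnds.netSum_of_notMem {A : Type*} [AddCommMonoid A] {G : Graph α β} {t h : β → α}
    (hG : G.IsEnds t h) {E : Finset β} (hE : ↑E ⊆ E(G)) (c : β → A) {x : α} (hx : x ∉ V(G)) :
    netSum E t h c x = 0 := by
  refine Finset.sum_eq_zero fun e he => ?_
  have hl := hG e (hE he)
  rw [if_neg, if_neg, add_zero]
  · rintro rfl; exact hx hl.right_mem
  · rintro rfl; exact hx hl.left_mem

lemma finsum_sub_eq_sum_dirInd (E : Finset β) (t h : β → α) (φ : β → ℤ) (x : α) :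
    ∑ᶠ e ∈ {e | e ∈ E ∧ t e = x}, φ e - ∑ᶠ e ∈ {e | e ∈ E ∧ h e = x}, φ e =
      ∑ e ∈ E, φ e * dirInd t h e x := by
  classical
  have (t : β → α) : {e | e ∈ E ∧ t e = x} = ↑(E.filter fun e => t e = x) := by ext; simp
  rw [this, this, finsum_mem_coe_finset, finsum_mem_coe_finset, Finset.sum_filter,
    Finset.sum_filter, ← Finset.sum_sub_distrib]
  refine Finset.sum_congr rfl fun e _ => ?_
  unfold dirInd
  split_ifs <;> simp

/-- An integer flow comes with its own orientation, whereas `netSum` is symmetric in the two ends of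
an edge; hence one fixed choice of ends serves for all Klein flows. -/
lemma hasNowhereZeroFlow_four_iff {G : Graph α β} {t h : β → α} (hth : G.IsEnds t h)
    {E : Finset β} (hE : ↑E = E(G)) : G.HasNowhereZeroFlow 4 ↔
    ∃ c : β → Klein, (∀ e ∈ E, c e ≠ 0) ∧ ∀ x, netSum E t h c x = 0 := by
  have hE' : ∀ e, e ∈ E(G) ↔ e ∈ E := fun e => by rw [← hE]; simp
  constructor
  · rintro ⟨t', h', φ, h1, h2⟩
    have hth' : G.IsEnds t' h' := fun e he => (h1 e he).1
    obtain ⟨c, hc, hx⟩ := (exists_klein_flow_iff E t' h').2 ⟨φ,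
      fun e he => ⟨(h1 e ((hE' e).2 he)).2.1, by exact_mod_cast (h1 e ((hE' e).2 he)).2.2⟩, by
        intro x
        by_cases hx : x ∈ V(G)
        · have := h2 x hx
          simp only [hE'] at this
          rw [← finsum_sub_eq_sum_dirInd, this, sub_self]
        · refine Finset.sum_eq_zero fun e he => ?_
          have hl := hth' e ((hE' e).2 he)
          rw [dirInd, if_neg, if_neg, sub_zero, mul_zero]
          · rintro rfl; exact hx hl.right_mem
          · rintro rfl; exact hx hl.left_mem⟩
    exact ⟨c, hc, fun x => by rw [hth.netSum_congr hth' hE.subset, hx]⟩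
  · intro hc
    obtain ⟨φ, h1, h2⟩ := (exists_klein_flow_iff E t h).1 hc
    refine ⟨t, h, φ, fun e he => ⟨hth e he, (h1 e ((hE' e).1 he)).1, ?_⟩, fun x _ => ?_⟩
    · exact_mod_cast (h1 e ((hE' e).1 he)).2
    · have := h2 x
      rw [← finsum_sub_eq_sum_dirInd, sub_eq_zero] at this
      simpa only [hE'] using this

end Ends

/-! ### Colourings as Klein flows; critical and 4-edge-critical -/

section Cubic

/-- A loop is counted in both summands of the degree, so three is either `3 + 0` or `2 + 1`. -/
lemma degree_eq_three_cases {G : Graph α β} {x : α} (hx : G.degree x = 3) :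
    (∃ p q r, p ≠ q ∧ p ≠ r ∧ q ≠ r ∧ (∀ e, G.Inc e x ↔ e = p ∨ e = q ∨ e = r) ∧
      ∀ e, ¬ G.IsLoopAt e x) ∨
    ∃ l p, l ≠ p ∧ G.IsLoopAt l x ∧ ¬ G.IsLoopAt p x ∧ ∀ e, G.Inc e x ↔ e = l ∨ e = p := by
  unfold degree at hx
  have hsub := G.loopSet_subset_incidenceSet x
  have hle := Set.encard_le_encard hsub
  have hi : (G.incidenceSet x).Finite := by
    rw [← Set.encard_ne_top_iff]; intro h; rw [h] at hx; simp at hx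
  have hl : (G.loopSet x).Finite := hi.subset hsub
  rw [← hi.cast_ncard_eq, ← hl.cast_ncard_eq] at hx hle
  norm_cast at hx hle
  have : (G.loopSet x).ncard = 0 ∨ (G.loopSet x).ncard = 1 := by omega
  rcases this with h0 | h1
  · left
    obtain ⟨p, q, r, hpq, hpr, hqr, hs⟩ :=
      Set.ncard_eq_three.1 (show (G.incidenceSet x).ncard = 3 by omega)
    rw [Set.ncard_eq_zero hl] at h0
    refine ⟨p, q, r, hpq, hpr, hqr, fun e => ?_, fun e he => ?_⟩
    · rw [← mem_incidenceSet, hs]; simp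
    · have : e ∈ G.loopSet x := he
      simp [h0] at this
  · right
    obtain ⟨l, hl1⟩ := Set.ncard_eq_one.1 h1
    have hlx : l ∈ G.loopSet x := by rw [hl1]; rfl
    obtain ⟨a, b, hab, hs⟩ := Set.ncard_eq_two.1 (show (G.incidenceSet x).ncard = 2 by omega)
    have hmem : ∀ e, G.Inc e x ↔ e = a ∨ e = b := fun e => by
      rw [← mem_incidenceSet, hs]; simp
    have hloop : ∀ e, G.IsLoopAt e x ↔ e = l := fun e => by
      rw [← mem_loopSet, hl1]; simp
    rcases (hmem l).1 (hsub hlx) with rfl | rfl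
    · exact ⟨l, b, hab, hlx, fun h => hab ((hloop b).1 h).symm, hmem⟩
    · exact ⟨l, a, hab.symm, hlx, fun h => hab ((hloop a).1 h), fun e => by rw [hmem, or_comm]⟩

lemma IsCubic.edgeSet_finite {G : Graph α β} (hG : G.IsCubic) : E(G).Finite := by
  refine (hG.1.biUnion (t := G.incidenceSet) fun x hx => ?_).subset fun e he => ?_
  · have := hG.2 x hx
    rw [← Set.encard_ne_top_iff]
    intro h
    rw [degree, h] at this
    simp at this
  · obtain ⟨x, y, h⟩ := exists_isLink_of_mem_edgeSet he
    exact Set.mem_biUnion h.left_mem h.inc_left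

lemma klein_add_self (a : Klein) : a + a = 0 := by revert a; decide

set_option synthInstance.maxSize 1000 in
lemma klein_sum_three : ∀ a b c : Klein, a ≠ 0 → b ≠ 0 → c ≠ 0 →
    (a + b + c = 0 ↔ a ≠ b ∧ a ≠ c ∧ b ≠ c) := by decide

open Classical in
lemma IsEnds.netSum_klein {G : Graph α β} {t h : β → α} (hG : G.IsEnds t h) {E : Finset β}
    (hE : ↑E = E(G)) (c : β → Klein) (x : α) :
    netSum E t h c x = ∑ e ∈ E with G.IsNonloopAt e x, c e := by
  rw [netSum, Finset.sum_filter]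
  refine Finset.sum_congr rfl fun e he => ?_
  have hl := hG e (hE ▸ he)
  by_cases h1 : t e = x <;> by_cases h2 : h e = x
  · rw [if_pos h1, if_pos h2, if_neg, klein_add_self]
    rw [h1, h2] at hl
    exact IsLoopAt.not_isNonloopAt hl x
  · rw [if_pos h1, if_neg h2, if_pos, add_zero]
    exact ⟨h e, h2, h1 ▸ hl⟩
  · rw [if_neg h1, if_pos h2, if_pos, zero_add]
    exact ⟨t e, h1, h2 ▸ hl.symm⟩
  · rw [if_neg h1, if_neg h2, if_neg, add_zero]
    intro h
    rcases h.inc.eq_or_eq_of_isLink hl with rfl | rfl <;> contradiction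

lemma IsEnds.netSum_klein_three {G : Graph α β} {t h : β → α} (hG : G.IsEnds t h) {E : Finset β}
    (hE : ↑E = E(G)) (c : β → Klein) {x : α} {p q r : β} (hpq : p ≠ q) (hpr : p ≠ r) (hqr : q ≠ r)
    (hinc : ∀ e, G.Inc e x ↔ e = p ∨ e = q ∨ e = r) (hloop : ∀ e, ¬ G.IsLoopAt e x) :
    netSum E t h c x = c p + c q + c r := by
  classical
  rw [hG.netSum_klein hE]
  have : E.filter (fun e => G.IsNonloopAt e x) = {p, q, r} := by
    ext e
    rw [Finset.mem_filter, isNonloopAt_iff_inc_not_isLoopAt, hinc, ← Finset.mem_coe, hE]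
    simp only [hloop, not_false_eq_true, and_true, Finset.mem_insert, Finset.mem_singleton,
      and_iff_right_iff_imp]
    exact fun h => ((hinc e).2 h).edge_mem
  rw [this, Finset.sum_insert (by simp [hpq, hpr]), Finset.sum_pair hqr, add_assoc]

lemma IsEnds.netSum_klein_loop {G : Graph α β} {t h : β → α} (hG : G.IsEnds t h) {E : Finset β}
    (hE : ↑E = E(G)) (c : β → Klein) {x : α} {l p : β} (hl : G.IsLoopAt l x)
    (hp : ¬ G.IsLoopAt p x) (hinc : ∀ e, G.Inc e x ↔ e = l ∨ e = p) :
    netSum E t h c x = c p := by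
  classical
  rw [hG.netSum_klein hE]
  have : E.filter (fun e => G.IsNonloopAt e x) = {p} := by
    ext e
    rw [Finset.mem_filter, isNonloopAt_iff_inc_not_isLoopAt, hinc, ← Finset.mem_coe, hE,
      Finset.mem_singleton]
    constructor
    · rintro ⟨-, rfl | rfl, h2⟩
      · exact absurd hl h2
      · rfl
    · rintro rfl
      exact ⟨((hinc e).2 (Or.inr rfl)).edge_mem, Or.inr rfl, hp⟩
  rw [this, Finset.sum_singleton]

/-- At a vertex of degree three, a nowhere-zero assignment of values in the Klein four-group
satisfies Kirchhoff's law if and only if it is a proper colouring. -/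
lemma IsEnds.netSum_eq_zero_iff {G : Graph α β} {t h : β → α} (hG : G.IsEnds t h) {E : Finset β}
    (hE : ↑E = E(G)) {c : β → Klein} {x : α} (hx : G.degree x = 3)
    (hc : ∀ e, G.Inc e x → c e ≠ 0) :
    netSum E t h c x = 0 ↔ (∀ e, ¬ G.IsLoopAt e x) ∧
      ∀ e f, G.Inc e x → G.Inc f x → e ≠ f → c e ≠ c f := by
  rcases degree_eq_three_cases hx with ⟨p, q, r, hpq, hpr, hqr, hinc, hloop⟩ |
    ⟨l, p, hlp, hl, hp, hinc⟩
  · rw [hG.netSum_klein_three hE c hpq hpr hqr hinc hloop, klein_sum_three _ _ _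
      (hc _ ((hinc p).2 (by simp))) (hc _ ((hinc q).2 (by simp))) (hc _ ((hinc r).2 (by simp)))]
    constructor
    · rintro ⟨h1, h2, h3⟩
      refine ⟨hloop, fun e f he hf hef => ?_⟩
      rcases (hinc e).1 he with rfl | rfl | rfl <;> rcases (hinc f).1 hf with rfl | rfl | rfl <;>
        first | contradiction | assumption | (apply Ne.symm; assumption)
    · rintro ⟨-, h⟩
      exact ⟨h _ _ ((hinc p).2 (by simp)) ((hinc q).2 (by simp)) hpq,
        h _ _ ((hinc p).2 (by simp)) ((hinc r).2 (by simp)) hpr,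
        h _ _ ((hinc q).2 (by simp)) ((hinc r).2 (by simp)) hqr⟩
  · rw [hG.netSum_klein_loop hE c hl hp hinc]
    constructor
    · intro h; exact absurd h (hc p ((hinc p).2 (by simp)))
    · rintro ⟨h, -⟩; exact absurd hl (h l)

/-- The nonzero element of the Klein four-group that represents a colour. -/
def colourVal : Fin 3 → Klein := ![(0, 1), (1, 0), (1, 1)]

/-- The colour represented by a nonzero element of the Klein four-group. -/
def valColour (a : Klein) : Fin 3 := if a = (0, 1) then 0 else if a = (1, 0) then 1 else 2

lemma colourVal_ne_zero : ∀ i, colourVal i ≠ 0 := by decide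

lemma colourVal_injective : ∀ i j, colourVal i = colourVal j → i = j := by decide

lemma valColour_injective : ∀ a b : Klein, a ≠ 0 → b ≠ 0 → valColour a = valColour b → a = b := by
  decide

/-- `c` is a nowhere-zero assignment of values in the Klein four-group that satisfies Kirchhoff's
law at every vertex outside `X`. -/
def IsKleinFlowOff (E : Finset β) (t h : β → α) (X : Set α) (c : β → Klein) : Prop :=
  (∀ e ∈ E, c e ≠ 0) ∧ ∀ x, x ∉ X → netSum E t h c x = 0

lemma isThreeEdgeColourable_iff {G : Graph α β} (hG : G.IsCubic) {t h : β → α}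
    (hth : G.IsEnds t h) {E : Finset β} (hE : ↑E = E(G)) :
    G.IsThreeEdgeColourable ↔ ∃ c, IsKleinFlowOff E t h ∅ c := by
  constructor
  · rintro ⟨hl, d, hd⟩
    refine ⟨fun e => colourVal (d e), fun e _ => colourVal_ne_zero _, fun x _ => ?_⟩
    by_cases hx : x ∈ V(G)
    · exact (hth.netSum_eq_zero_iff hE (hG.2 x hx) fun e _ => colourVal_ne_zero _).2
        ⟨fun e => hl e x, fun e f he hf hef h => hd x e f he hf hef (colourVal_injective _ _ h)⟩
    · exact hth.netSum_of_notMem hE.subset _ hx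
  · rintro ⟨c, hc, hx⟩
    have hnz : ∀ x e, G.Inc e x → c e ≠ 0 := fun x e he =>
      hc e (by rw [← Finset.mem_coe, hE]; exact he.edge_mem)
    have key := fun x (hxG : x ∈ V(G)) =>
      (hth.netSum_eq_zero_iff hE (hG.2 x hxG) (hnz x)).1 (hx x (Set.notMem_empty x))
    exact ⟨fun e x hl => (key x hl.vertex_mem).1 e hl, fun e => valColour (c e),
      fun x e f he hf hef h => (key x he.vertex_mem).2 e f he hf hef
        (valColour_injective _ _ (hnz x e he) (hnz x f hf) h)⟩

lemma IsLink.removeVerts {G : Graph α β} {X : Set α} {e : β} {x y : α} (h : G.IsLink e x y)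
    (hx : x ∉ X) : (G.removeVerts X).IsLink e (Sum.inl x) (endAfter X e y) :=
  ⟨x, y, h, Or.inl hx, by simp [endAfter, hx], rfl⟩

lemma Inc.removeVerts {G : Graph α β} {X : Set α} {e : β} {x : α} (h : G.Inc e x)
    (hx : x ∉ X) : (G.removeVerts X).Inc e (Sum.inl x) :=
  h.choose_spec.removeVerts hx |>.inc_left

lemma IsLoopAt.removeVerts {G : Graph α β} {X : Set α} {e : β} {x : α} (h : G.IsLoopAt e x)
    (hx : x ∉ X) : (G.removeVerts X).IsLoopAt e (Sum.inl x) :=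
  ⟨x, x, h, Or.inl hx, by simp [endAfter, hx], by simp [endAfter, hx]⟩

lemma endAfter_eq_inl {X : Set α} {e : β} {x y : α} (h : Sum.inl x = endAfter X e y) :
    y = x ∧ x ∉ X := by
  unfold endAfter at h
  split_ifs at h with hy
  obtain rfl := Sum.inl_injective h
  exact ⟨rfl, hy⟩

lemma endAfter_eq_inr {X : Set α} {e f : β} {y : α} (h : Sum.inr f = endAfter X e y) :
    f = e ∧ y ∈ X := by
  unfold endAfter at h
  split_ifs at h with hy
  exact ⟨Sum.inr_injective h, hy⟩

/-- A free end meets only one edge and carries no loop, because edges with all ends in `X` are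
removed. So only the surviving vertices impose conditions. -/
lemma removeVerts_colourable_iff_proper {G : Graph α β} (X : Set α) :
    (G.removeVerts X).IsThreeEdgeColourable ↔ (∀ x ∉ X, ∀ e, ¬ G.IsLoopAt e x) ∧
      ∃ c : β → Fin 3, ∀ x ∉ X, ∀ e f, G.Inc e x → G.Inc f x → e ≠ f → c e ≠ c f := by
  constructor
  · rintro ⟨hl, d, hd⟩
    exact ⟨fun x hx e he => hl e _ (he.removeVerts hx), d, fun x hx e f he hf hef =>
      hd _ e f (he.removeVerts hx) (hf.removeVerts hx) hef⟩
  · rintro ⟨hl, c, hc⟩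
    refine ⟨?_, c, ?_⟩
    · rintro e (x | f) ⟨y, z, hyz, hX, h1, h2⟩
      · obtain ⟨rfl, hyX⟩ := endAfter_eq_inl h1
        obtain ⟨rfl, -⟩ := endAfter_eq_inl h2
        exact hl _ hyX e hyz
      · have := (endAfter_eq_inr h1).2
        have := (endAfter_eq_inr h2).2
        tauto
    · rintro (x | g) e f ⟨_, y, z, hyz, hX, h1, -⟩ ⟨_, y', z', hyz', hX', h1', -⟩ hef
      · obtain ⟨rfl, hyX⟩ := endAfter_eq_inl h1
        obtain ⟨rfl, -⟩ := endAfter_eq_inl h1'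
        exact hc _ hyX e f hyz.inc_left hyz'.inc_left hef
      · exact fun _ => hef ((endAfter_eq_inr h1).1.symm.trans (endAfter_eq_inr h1').1)

lemma removeVerts_colourable_iff {G : Graph α β} (hG : G.IsCubic) {t h : β → α}
    (hth : G.IsEnds t h) {E : Finset β} (hE : ↑E = E(G)) (X : Set α) :
    (G.removeVerts X).IsThreeEdgeColourable ↔ ∃ c, IsKleinFlowOff E t h X c := by
  rw [removeVerts_colourable_iff_proper]
  constructor
  · rintro ⟨hl, d, hd⟩
    refine ⟨fun e => colourVal (d e), fun e _ => colourVal_ne_zero _, fun x hxX => ?_⟩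
    by_cases hx : x ∈ V(G)
    · exact (hth.netSum_eq_zero_iff hE (hG.2 x hx) fun e _ => colourVal_ne_zero _).2
        ⟨hl x hxX, fun e f he hf hef h => hd x hxX e f he hf hef (colourVal_injective _ _ h)⟩
    · exact hth.netSum_of_notMem hE.subset _ hx
  · rintro ⟨c, hc, hx⟩
    have hnz : ∀ x e, G.Inc e x → c e ≠ 0 := fun x e he =>
      hc e (by rw [← Finset.mem_coe, hE]; exact he.edge_mem)
    have key := fun x (hxG : x ∈ V(G)) (hxX : x ∉ X) =>
      (hth.netSum_eq_zero_iff hE (hG.2 x hxG) (hnz x)).1 (hx x hxX)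
    exact ⟨fun x hxX e hl => (key x hl.vertex_mem hxX).1 e hl, fun e => valColour (c e),
      fun x hxX e f he hf hef h => (key x he.vertex_mem hxX).2 e f he hf hef
        (valColour_injective _ _ (hnz x e he) (hnz x f hf) h)⟩

lemma IsEnds.sum_netSum {A : Type*} [AddCommMonoid A] {G : Graph α β} {V : Finset α}
    (hV : ↑V = V(G)) {t h : β → α} (hth : G.IsEnds t h) {E : Finset β} (hE : ↑E = E(G)) (c : β → A) :
    ∑ x ∈ V, netSum E t h c x = ∑ e ∈ E, (c e + c e) := by
  classical
  unfold netSum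
  rw [Finset.sum_comm]
  refine Finset.sum_congr rfl fun e he => ?_
  have hl := hth e (hE ▸ he)
  rw [Finset.sum_add_distrib, Finset.sum_ite_eq, Finset.sum_ite_eq, if_pos, if_pos]
  · rw [← Finset.mem_coe, hV]; exact hl.right_mem
  · rw [← Finset.mem_coe, hV]; exact hl.left_mem

/-- In the sum over all vertices every value occurs twice and cancels; only the terms at `u` and `v`
can survive. In particular Kirchhoff's law at one of them implies it at the other. -/
lemma IsEnds.netSum_add_eq_zero {G : Graph α β} (hG : V(G).Finite) {t h : β → α}
    (hth : G.IsEnds t h) {E : Finset β} (hE : ↑E = E(G)) {u v : α} (huv : u ≠ v) (hu : u ∈ V(G))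
    (hv : v ∈ V(G)) {c : β → Klein} (hc : ∀ x, x ∉ ({u, v} : Set α) → netSum E t h c x = 0) :
    netSum E t h c u + netSum E t h c v = 0 := by
  classical
  have h1 : ∑ x ∈ hG.toFinset, netSum E t h c x = 0 := by
    rw [hth.sum_netSum hG.coe_toFinset hE]
    exact Finset.sum_eq_zero fun e _ => klein_add_self _
  rw [← Finset.sum_pair huv, ← h1]
  refine Finset.sum_subset ?_ fun x _ hx => hc x (by simpa using hx)
  intro x hx
  rcases Finset.mem_insert.1 hx with rfl | hx
  · simpa using hu
  · simpa [Finset.mem_singleton.1 hx] using hv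

/-- The net sum at the merged vertex is the sum of those at `u` and `v`, which is zero
automatically; all other vertices are unaffected. -/
lemma identify_hasNowhereZeroFlow_iff {G : Graph α β} (hG : V(G).Finite) {t h : β → α}
    (hth : G.IsEnds t h) {E : Finset β} (hE : ↑E = E(G)) {u v : α} (huv : u ≠ v) (hu : u ∈ V(G))
    (hv : v ∈ V(G)) :
    (G.identify u v).HasNowhereZeroFlow 4 ↔ ∃ c, IsKleinFlowOff E t h {u, v} c := by
  classical
  set φ : α → α := fun x => if x = v then u else x with hφ
  have hid : G.identify u v = G.map φ := by unfold identify; congr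
  have hth' : (G.map φ).IsEnds (φ ∘ t) (φ ∘ h) := fun e he => (hth e he).map φ
  have hoff : ∀ (c : β → Klein) x, x ∉ ({u, v} : Set α) →
      netSum E (φ ∘ t) (φ ∘ h) c x = netSum E t h c x := by
    intro c x hx
    simp only [Set.mem_insert_iff, Set.mem_singleton_iff, not_or] at hx
    have : ∀ y, φ y = x ↔ y = x := fun y => by
      simp only [hφ]
      split_ifs with hy
      · subst hy; exact ⟨fun h => absurd h.symm hx.1, fun h => absurd h.symm hx.2⟩
      · rfl
    simp [netSum, this]
  have hsum : ∀ c : β → Klein, netSum E (φ ∘ t) (φ ∘ h) c u =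
      netSum E t h c u + netSum E t h c v := by
    intro c
    have : ∀ (y : α) (a : Klein), (if φ y = u then a else 0) =
        (if y = u then a else 0) + if y = v then a else 0 := fun y a => by
      simp only [hφ]
      by_cases hy : y = v
      · simp [hy, huv.symm]
      · simp [hy]
    simp only [netSum, Function.comp, this]
    rw [← Finset.sum_add_distrib]
    exact Finset.sum_congr rfl fun e _ => by abel
  have hzero : ∀ c : β → Klein, netSum E (φ ∘ t) (φ ∘ h) c v = 0 := by
    intro c
    have : ∀ y, φ y ≠ v := fun y => by
      simp only [hφ]
      split_ifs with hy
      · exact huv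
      · exact hy
    simp [netSum, this]
  rw [hid, hasNowhereZeroFlow_four_iff hth' (E := E) hE]
  refine exists_congr fun c => and_congr_right fun _ => ⟨fun h x hx => hoff c x hx ▸ h x, ?_⟩
  intro h x
  by_cases hxu : x = u
  · rw [hxu, hsum, hth.netSum_add_eq_zero hG hE huv hu hv h]
  by_cases hxv : x = v
  · rw [hxv, hzero]
  have : x ∉ ({u, v} : Set α) := by simp [hxu, hxv]
  rw [hoff c x this, h x this]

theorem isCritical_iff_isEdgeCritical {G : Graph α β} (hG : G.IsSnark) :
    G.IsCritical ↔ G.IsEdgeCritical 4 := by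
  have : Nonempty α := hG.1.1.to_type
  obtain ⟨t, h, hth⟩ := G.exists_isEnds
  have hE := hG.2.1.edgeSet_finite.coe_toFinset
  have hno : ¬ G.HasNowhereZeroFlow 4 := by
    rw [hasNowhereZeroFlow_four_iff hth hE]
    have := hG.2.2
    rw [isThreeEdgeColourable_iff hG.2.1 hth hE] at this
    simpa [IsKleinFlowOff] using this
  simp only [IsCritical, IsEdgeCritical, hno, not_false_eq_true, true_and]
  refine forall₄_congr fun u v huv hadj => ?_
  rw [removeVerts_colourable_iff hG.2.1 hth hE, identify_hasNowhereZeroFlow_iff hG.2.1.1 hth hE huv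
    hadj.left_mem hadj.right_mem]

end Cubic

/-! ### Threads through vertices of degree two -/

section Thread

lemma IsThread.exists_cons {G : Graph α β} {S : Set α} {x y : α} {l : List β}
    (h : G.IsThread S x l y) : ∃ f l', l = f :: l' ∧ G.Inc f x := by
  cases h with
  | single h => exact ⟨_, _, rfl, h.inc_left⟩
  | cons h _ _ _ => exact ⟨_, _, rfl, h.inc_left⟩

lemma IsThread.exists_inc_right {G : Graph α β} {S : Set α} {x y : α} {l : List β}
    (h : G.IsThread S x l y) : ∃ f ∈ l, G.Inc f y := by
  obtain ⟨f, hf, hi⟩ := h.reverse.exists_inc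
  exact ⟨f, by simpa using hf, hi⟩

/-- If at most two edges meet at each vertex in `S`, a thread between vertices outside `S` is
determined by its first vertex and its first edge. -/
lemma IsThread.eq_of_head {G : Graph α β} {S : Set α}
    (hS : ∀ w ∈ S, ∀ f g g', G.Inc f w → G.Inc g w → G.Inc g' w → g ≠ f → g' ≠ f → g = g')
    {x y : α} {l : List β} (h : G.IsThread S x l y) (hy : y ∉ S) :
    ∀ {l' y'}, G.IsThread S x l' y' → y' ∉ S → l.head? = l'.head? → l = l' := by
  induction h with
  | single h =>
    intro l' y' h' hy' hh
    cases h' with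
    | single h' => simpa using hh
    | cons h' hw _ _ =>
      simp only [List.head?_cons, Option.some.injEq] at hh
      subst hh
      exact absurd (h.right_unique h' ▸ hw) hy
  | @cons f l x w y h hw hf hl ih =>
    intro l' y' h' hy' hh
    cases h' with
    | single h' =>
      simp only [List.head?_cons, Option.some.injEq] at hh
      subst hh
      exact absurd (h.right_unique h' ▸ hw) hy'
    | cons h' hw' hf' hl' =>
      simp only [List.head?_cons, Option.some.injEq] at hh
      subst hh
      obtain rfl := h.right_unique h'
      rw [ih hy hl' hy']
      obtain ⟨g, l₁, rfl, hg⟩ := hl.exists_cons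
      obtain ⟨g', l₁', rfl, hg'⟩ := hl'.exists_cons
      simp only [List.mem_cons, not_or] at hf hf'
      simp [hS w hw f g g' h.inc_right hg hg' (Ne.symm hf.1) (Ne.symm hf'.1)]

lemma IsThread.exists_const {G : Graph α β} {S : Set α} {γ : Type*} {c : β → γ}
    (hc : ∀ w ∈ S, ∀ f g, G.Inc f w → G.Inc g w → c f = c g) {x y : α} {l : List β}
    (h : G.IsThread S x l y) : ∃ a, ∀ g ∈ l, c g = a := by
  induction h with
  | single h => exact ⟨_, fun g hg => by rw [List.mem_singleton.1 hg]⟩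
  | @cons f l x w y h hw hf hl ih =>
    obtain ⟨a, ha⟩ := ih
    obtain ⟨g, l₁, rfl, hg⟩ := hl.exists_cons
    refine ⟨a, fun k hk => ?_⟩
    rcases List.mem_cons.1 hk with rfl | hk
    · rw [hc w hw k g h.inc_right hg, ha g (by simp)]
    · exact ha k hk

/-- A thread from `x ∉ S` with a second edge incident with `x` returns to `x`. -/
lemma IsThread.eq_of_mem_of_inc {G : Graph α β} {S : Set α} {x y : α} {f g : β} {l : List β}
    (h : G.IsThread S x (f :: l) y) (hx : x ∉ S) (hg : g ∈ l) (hgx : G.Inc g x) : x = y := by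
  cases h with
  | single h => simp at hg
  | cons h hw hf hl =>
    rcases hl.eq_or_eq hg hgx hx with rfl | h
    · exact absurd hw hx
    · exact h

end Thread

/-! ### Critical snarks and `G ∼ e` -/

section DeleteSuppress

/-- Without `e`, at most two edges remain at an end of `e`; this is what `IsThread.eq_of_head`
requires. -/
lemma edge_unique_of_deleteEdges {G : Graph α β} (hG : G.IsCubic) {e : β} :
    ∀ w ∈ {x | G.Inc e x}, ∀ f g g',
      (G.deleteEdges {e}).Inc f w → (G.deleteEdges {e}).Inc g w → (G.deleteEdges {e}).Inc g' w →
      g ≠ f → g' ≠ f → g = g' := by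
  intro w hw f g g' hf hg hg' hgf hgf'
  simp only [deleteEdges_inc, Set.mem_singleton_iff, Set.mem_ofPred_eq] at hw hf hg hg'
  rcases degree_eq_three_cases (hG.2 w hw.vertex_mem) with ⟨p, q, r, hpq, hpr, hqr, hinc, -⟩ |
    ⟨l, p, hlp, hl, hp, hinc⟩
  · simp only [hinc] at hw hf hg hg'
    grind
  · simp only [hinc] at hw hf hg hg'
    grind

lemma exists_next_edge {G : Graph α β} (hG : G.IsCubic) {e f : β} {w : α}
    (hloop : ∀ x, ¬ G.IsLoopAt e x) (he : G.Inc e w) (hf : G.Inc f w) (hfe : f ≠ e)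
    (hfl : ¬ G.IsLoopAt f w) :
    ∃ g y, g ≠ f ∧ g ≠ e ∧ y ≠ w ∧ G.IsLink g w y := by
  rcases degree_eq_three_cases (hG.2 w he.vertex_mem) with ⟨p, q, r, hpq, hpr, hqr, hinc, hl⟩ |
    ⟨l, p, hlp, hl, hp, hinc⟩
  · have : ∃ g, g ≠ f ∧ g ≠ e ∧ G.Inc g w := by
      simp only [hinc] at he hf ⊢
      have : (p ≠ f ∧ p ≠ e) ∨ (q ≠ f ∧ q ≠ e) ∨ r ≠ f ∧ r ≠ e := by grind
      rcases this with h | h | h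
      exacts [⟨p, h.1, h.2, by simp⟩, ⟨q, h.1, h.2, by simp⟩, ⟨r, h.1, h.2, by simp⟩]
    obtain ⟨g, hgf, hge, y, hy⟩ := this
    exact ⟨g, y, hgf, hge, fun h => hl g (h ▸ hy : G.IsLink g w w), hy⟩
  · rcases (hinc e).1 he with rfl | rfl
    · exact absurd hl (hloop w)
    · rcases (hinc f).1 hf with rfl | rfl
      · exact absurd hl hfl
      · exact absurd rfl hfe

/-- The inner vertices must be ends of `e`, and there are at most two of these, so following `f`
leads out after at most three edges. -/
lemma exists_thread {G : Graph α β} (hG : G.IsCubic) {e f : β} {x : α}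
    (hloop : ∀ x, ¬ G.IsLoopAt e x) (hx : ¬ G.Inc e x) (hf : G.Inc f x) :
    ∃ l y, ¬ G.Inc e y ∧ (G.deleteEdges {e}).IsThread {x | G.Inc e x} x (f :: l) y := by
  have hlink : ∀ {g a b}, G.IsLink g a b → g ≠ e → (G.deleteEdges {e}).IsLink g a b :=
    fun h hg => by simpa using ⟨h, hg⟩
  have hfe : f ≠ e := by rintro rfl; exact hx hf
  obtain ⟨w, hw⟩ := hf
  by_cases hwS : G.Inc e w
  swap
  · exact ⟨[], w, hwS, .single (hlink hw hfe)⟩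
  have hxw : x ≠ w := by rintro rfl; exact hx hwS
  obtain ⟨g, w₂, hgf, hge, hw₂, hg⟩ := exists_next_edge hG hloop hwS hw.inc_right hfe
    fun hl => hxw (hl.eq_of_inc hw.inc_left).symm
  by_cases hwS₂ : G.Inc e w₂
  swap
  · exact ⟨[g], w₂, hwS₂, .cons (hlink hw hfe) hwS (by simpa using hgf.symm)
      (.single (hlink hg hge))⟩
  obtain ⟨k, y, hkg, hke, hy, hk⟩ := exists_next_edge hG hloop hwS₂ hg.inc_right hge
    fun hl => hw₂ (hl.eq_of_inc hg.inc_left)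
  have hfk : f ≠ k := by
    rintro rfl
    rcases hk.inc_left.eq_or_eq_of_isLink hw with rfl | rfl
    · exact hx hwS₂
    · exact hw₂ rfl
  refine ⟨[g, k], y, fun hyS => ?_, .cons (hlink hw hfe) hwS (by simp [hgf.symm, hfk])
    (.cons (hlink hg hge) hwS₂ (by simpa using hkg.symm) (.single (hlink hk hke)))⟩
  -- Two of three ends of `e` coincide. Consecutive ones would give a loop, and `w = y` would put
  -- `f`, `g`, `k` and `e` all at `w`.
  rcases Inc.eq_or_eq_or_eq hwS hwS₂ hyS with h | rfl | h
  · exact hw₂ h.symm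
  · exact hfk (edge_unique_of_deleteEdges hG w hwS g f k (hlink hg hge).inc_left
      (hlink hw hfe).inc_right (hlink hk hke).inc_right hgf.symm hkg)
  · exact hy h.symm

lemma deleteSuppress_colourable_of_flow {G : Graph α β} (hG : G.IsCubic) {t h : β → α}
    (hth : G.IsEnds t h) {E : Finset β} (hE : ↑E = E(G)) {e : β} {u v : α} (huv : u ≠ v)
    (he : G.IsLink e u v) (hno : ¬ ∃ c, IsKleinFlowOff E t h ∅ c) {c : β → Klein}
    (hc : IsKleinFlowOff E t h {u, v} c) : (G.deleteSuppress e).IsThreeEdgeColourable := by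
  classical
  have hloop : ∀ x, ¬ G.IsLoopAt e x := fun x hx =>
    huv ((hx.eq_of_inc he.inc_left).symm.trans (hx.eq_of_inc he.inc_right))
  have hS : ∀ x, x ∈ {x | G.Inc e x} ↔ x ∈ ({u, v} : Set α) := fun x => by
    constructor
    · intro h; exact h.eq_or_eq_of_isLink he
    · rintro (rfl | rfl)
      exacts [he.inc_left, he.inc_right]
  have hmemE : ∀ f, f ∈ E ↔ f ∈ E(G) := fun f => by rw [← Finset.mem_coe, hE]
  have hnz : ∀ x f, G.Inc f x → c f ≠ 0 := fun x f hf => hc.1 f ((hmemE f).2 hf.edge_mem)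
  have heq : ∀ w ∈ {x | G.Inc e x}, ∀ f g, (G.deleteEdges {e}).Inc f w →
      (G.deleteEdges {e}).Inc g w → c f = c g := by
    intro w hw f g hf hg
    simp only [deleteEdges_inc, Set.mem_singleton_iff] at hf hg
    by_contra hne
    have hfg : f ≠ g := fun h => hne (h ▸ rfl)
    apply hno
    -- The new value of `e` is nonzero because `c f ≠ c g`, and it balances `w`. The law at the
    -- other end of `e` then follows from the sum over all vertices, contradicting `hno`.
    refine ⟨Function.update c e (c f + c g), fun k hk => ?_, ?_⟩
    · by_cases hke : k = e
      · subst hke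
        rw [Function.update_self]
        intro h0
        apply hne
        rw [← add_zero (c f), ← klein_add_self (c g), ← add_assoc, h0, zero_add]
      · rw [Function.update_of_ne hke]
        exact hc.1 k hk
    have hoff : ∀ x, x ∉ ({u, v} : Set α) →
        netSum E t h (Function.update c e (c f + c g)) x = 0 := by
      intro x hx
      rw [← hc.2 x hx, hth.netSum_klein hE, hth.netSum_klein hE]
      refine Finset.sum_congr rfl fun k hk => Function.update_of_ne ?_ ..
      rintro rfl
      exact hx ((hS x).1 (Finset.mem_filter.1 hk).2.inc)
    have hsum := hth.netSum_add_eq_zero hG.1 hE huv he.left_mem he.right_mem hoff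
    have hw0 : netSum E t h (Function.update c e (c f + c g)) w = 0 := by
      have hew : G.Inc e w := hw
      rcases degree_eq_three_cases (hG.2 w hew.vertex_mem) with ⟨p, q, r, hpq, hpr, hqr, hinc, hl⟩ |
        ⟨l, p, hlp, hl, hp, hinc⟩
      · have hinc' : ∀ k, G.Inc k w ↔ k = e ∨ k = f ∨ k = g := by
          have h1 := (hinc e).1 hw
          have h2 := (hinc f).1 hf.1
          have h3 := (hinc g).1 hg.1
          have h4 := hf.2
          have h5 := hg.2
          intro k
          rw [hinc]
          grind
        rw [hth.netSum_klein_three hE _ (Ne.symm hf.2) (Ne.symm hg.2) hfg hinc' hl,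
          Function.update_self, Function.update_of_ne hf.2, Function.update_of_ne hg.2, add_assoc,
          klein_add_self]
      · exfalso
        rcases (hinc e).1 hw with rfl | rfl
        · exact hloop w hl
        · rcases (hinc f).1 hf.1 with rfl | rfl
          · rcases (hinc g).1 hg.1 with rfl | rfl
            exacts [hfg rfl, hg.2 rfl]
          · exact hf.2 rfl
    intro x _
    by_cases hx : x ∈ ({u, v} : Set α)
    · have hw' : w = u ∨ w = v := (hS w).1 hw
      have hx' : x = u ∨ x = v := hx
      rcases hw' with h1 | h1 <;> rw [h1] at hw0
      · rw [hw0, zero_add] at hsum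
        rcases hx' with h2 | h2 <;> rw [h2] <;> assumption
      · rw [hw0, add_zero] at hsum
        rcases hx' with h2 | h2 <;> rw [h2] <;> assumption
    · exact hoff x hx
  have key := fun x (hxG : x ∈ V(G)) (hx : x ∉ ({u, v} : Set α)) =>
    (hth.netSum_eq_zero_iff hE (hG.2 x hxG) (hnz x)).1 (hc.2 x hx)
  -- A thread takes the colour of any of its edges; the value at `∅` is irrelevant, since threads
  -- are nonempty.
  set d : Set β → Fin 3 := fun F => if hF : F.Nonempty then valColour (c hF.some) else 0 with hd
  have hdF : ∀ {x y l}, (G.deleteEdges {e}).IsThread {x | G.Inc e x} x l y →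
      ∀ f ∈ l, d {g | g ∈ l} = valColour (c f) := by
    intro x y l hl f hf
    obtain ⟨a, ha⟩ := hl.exists_const heq
    have hne : ({g | g ∈ l} : Set β).Nonempty := ⟨f, hf⟩
    simp only [hd]
    rw [dif_pos hne, ha f hf, ha _ hne.some_mem]
  refine ⟨?_, d, ?_⟩
  -- A loop after suppression is either a loop of `G` at `x` or a closed thread whose first and last
  -- edges are distinct but have the same value at `x`.
  · rintro F x ⟨hx, -, l, hl, rfl⟩
    have hx' : x ∉ ({u, v} : Set α) := fun h => hx ((hS x).2 h)
    obtain ⟨a, ha⟩ := hl.exists_const heq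
    cases hl with
    | single h =>
      rw [deleteEdges_isLink] at h
      exact (key x h.1.left_mem hx').1 _ h.1
    | cons h hw hf hl =>
      obtain ⟨g, hg, hgx⟩ := hl.exists_inc_right
      have h1 := h.inc_left
      rw [deleteEdges_inc] at hgx h1
      refine (key x h1.1.vertex_mem hx').2 _ _ h1.1 hgx.1 (fun h => hf (h ▸ hg)) ?_
      rw [ha _ List.mem_cons_self, ha _ (List.mem_cons_of_mem _ hg)]
  · rintro x F F' ⟨y, hx, hy, l, hl, rfl⟩ ⟨y', -, hy', l', hl', rfl⟩ hne h
    have hx' : x ∉ ({u, v} : Set α) := fun h => hx ((hS x).2 h)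
    obtain ⟨f, l₁, hfl, hf⟩ := hl.exists_cons
    obtain ⟨f', l₁', hfl', hf'⟩ := hl'.exists_cons
    rw [deleteEdges_inc] at hf hf'
    by_cases hff : f = f'
    · exact hne (by rw [hl.eq_of_head (edge_unique_of_deleteEdges hG) hy hl' hy'
        (by rw [hfl, hfl', hff]; rfl)])
    · rw [hdF hl f (by simp [hfl]), hdF hl' f' (by simp [hfl'])] at h
      exact (key x hf.1.vertex_mem hx').2 f f' hf.1 hf'.1 hff
        (valColour_injective _ _ (hnz x f hf.1) (hnz x f' hf'.1) h)

lemma exists_flow_of_deleteSuppress_colourable {G : Graph α β} (hG : G.IsCubic) {t h : β → α}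
    (hth : G.IsEnds t h) {E : Finset β} (hE : ↑E = E(G)) {e : β}
    (hloop : ∀ x, ¬ G.IsLoopAt e x) (hcol : (G.deleteSuppress e).IsThreeEdgeColourable) :
    ∃ c, IsKleinFlowOff E t h {x | G.Inc e x} c := by
  classical
  obtain ⟨hl, d, hd⟩ := hcol
  set S : Set α := {x | G.Inc e x} with hS
  -- `p` records the start, the edges after `f` and the end of a thread with first edge `f`. If two
  -- such threads start at different vertices, these are the two ends of `f`, both outside `S`, and
  -- each thread is `f` alone; hence the edge set is unique.
  set P : β → α × List β × α → Prop := fun f p => p.1 ∉ S ∧ p.2.2 ∉ S ∧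
    (G.deleteEdges {e}).IsThread S p.1 (f :: p.2.1) p.2.2 with hP
  have huniq : ∀ {f p q}, P f p → P f q → {g | g ∈ f :: p.2.1} = {g | g ∈ f :: q.2.1} := by
    rintro f ⟨x, l, y⟩ ⟨x', l', y'⟩ ⟨hx, hy, hp⟩ ⟨hx', hy', hq⟩
    simp only at hx hy hp hx' hy' hq ⊢
    by_cases hxx : x = x'
    · subst hxx
      rw [hp.eq_of_head (edge_unique_of_deleteEdges hG) hy hq hy' rfl]
    · cases hp with
      | single h1 =>
        cases hq with
        | single h2 => rfl
        | cons h2 hw _ _ =>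
          rcases h1.eq_and_eq_or_eq_and_eq h2 with ⟨rfl, rfl⟩ | ⟨rfl, rfl⟩
          · exact absurd rfl hxx
          · exact absurd hw hx
      | cons h1 hw _ _ =>
        cases hq with
        | single h2 =>
          rcases h2.eq_and_eq_or_eq_and_eq h1 with ⟨rfl, rfl⟩ | ⟨rfl, rfl⟩
          · exact absurd rfl hxx
          · exact absurd hw hx'
        | cons h2 hw' _ _ =>
          rcases h2.eq_and_eq_or_eq_and_eq h1 with ⟨rfl, rfl⟩ | ⟨rfl, rfl⟩
          · exact absurd rfl hxx
          · exact absurd hw hx'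
  set F : β → Set β := fun f => if hf : ∃ p, P f p then {g | g ∈ f :: hf.choose.2.1} else ∅ with hF
  have hFeq : ∀ {f p}, P f p → F f = {g | g ∈ f :: p.2.1} := by
    intro f p hp
    have hf : ∃ p, P f p := ⟨p, hp⟩
    simp only [hF]
    rw [dif_pos hf]
    exact huniq hf.choose_spec hp
  refine ⟨fun f => colourVal (d (F f)), fun _ _ => colourVal_ne_zero _, fun x hxS => ?_⟩
  by_cases hxG : x ∈ V(G)
  swap
  · exact hth.netSum_of_notMem hE.subset _ hxG
  refine (hth.netSum_eq_zero_iff hE (hG.2 x hxG) fun _ _ => colourVal_ne_zero _).2 ⟨?_, ?_⟩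
  · intro f hf
    refine hl {f} x ⟨hxS, hxS, [f], .single ?_, by simp⟩
    rw [deleteEdges_isLink]
    exact ⟨hf, by rintro rfl; exact hloop x hf⟩
  · intro f g hf hg hfg heq
    obtain ⟨l, y, hy, hth1⟩ := exists_thread hG hloop hxS hf
    obtain ⟨l', y', hy', hth2⟩ := exists_thread hG hloop hxS hg
    have h1 : F f = _ := hFeq (p := (x, l, y)) ⟨hxS, hy, hth1⟩
    have h2 : F g = _ := hFeq (p := (x, l', y')) ⟨hxS, hy', hth2⟩
    -- If the thread from `x` through `f` also used `g`, it would return to `x` and become a loop of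
    -- `G ∼ e`.
    have hne : F f ≠ F g := by
      intro h3
      have hgl : g ∈ f :: l := by
        have : g ∈ F g := by rw [h2]; simp
        rw [← h3, h1] at this
        exact this
      have hgl : g ∈ l := (List.mem_cons.1 hgl).resolve_left hfg.symm
      have hgx : (G.deleteEdges {e}).Inc g x := by
        rw [deleteEdges_inc]
        exact ⟨hg, by rintro rfl; exact hxS hg⟩
      obtain rfl := hth1.eq_of_mem_of_inc hxS hgl hgx
      exact hl _ x ⟨hxS, hxS, _, hth1, rfl⟩
    exact hd x (F f) (F g) ⟨y, hxS, hy, _, hth1, h1.symm⟩ ⟨y', hxS, hy', _, hth2, h2.symm⟩ hne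
      (colourVal_injective _ _ heq)

theorem isCritical_iff_deleteSuppress {G : Graph α β} (hG : G.IsSnark) :
    G.IsCritical ↔
      ∀ e ∈ E(G), (∀ x, ¬ G.IsLoopAt e x) → (G.deleteSuppress e).IsThreeEdgeColourable := by
  have : Nonempty α := hG.1.1.to_type
  obtain ⟨t, h, hth⟩ := G.exists_isEnds
  have hE := hG.2.1.edgeSet_finite.coe_toFinset
  constructor
  · intro hcrit e he hloop
    have hl := hth e he
    have huv : t e ≠ h e := fun heq => hloop (t e) (by rw [← heq] at hl; exact hl)
    obtain ⟨c, hc⟩ := (removeVerts_colourable_iff hG.2.1 hth hE _).1 (hcrit _ _ huv hl.adj)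
    exact deleteSuppress_colourable_of_flow hG.2.1 hth hE huv hl
      (fun h => hG.2.2 ((isThreeEdgeColourable_iff hG.2.1 hth hE).2 h)) hc
  · rintro hcol u v huv ⟨e, he⟩
    have hloop : ∀ x, ¬ G.IsLoopAt e x := fun x hx =>
      huv ((hx.eq_of_inc he.inc_left).symm.trans (hx.eq_of_inc he.inc_right))
    obtain ⟨c, hc⟩ := exists_flow_of_deleteSuppress_colourable hG.2.1 hth hE hloop
      (hcol e he.edge_mem hloop)
    refine (removeVerts_colourable_iff hG.2.1 hth hE _).2
      ⟨c, hc.1, fun x hx => hc.2 x fun h => hx ?_⟩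
    exact Inc.eq_or_eq_of_isLink h he

end DeleteSuppress

/-! ### Degrees and the handshake lemma -/

section Degree

/-- The edges with tail `x` and those with head `x` have the incidence set as union and the loop set
as intersection. -/
lemma IsEnds.degree_eq {G : Graph α β} {t h : β → α} (hth : G.IsEnds t h) {E : Finset β}
    (hE : ↑E = E(G)) (x : α) : G.degree x = (netSum E t h (fun _ => (1 : ℕ)) x : ℕ) := by
  classical
  have hmem : ∀ e, e ∈ E ↔ e ∈ E(G) := fun e => by rw [← Finset.mem_coe, hE]
  have h1 : G.incidenceSet x = ↑(E.filter (fun e => t e = x) ∪ E.filter (fun e => h e = x)) := by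
    ext e
    simp only [mem_incidenceSet, Finset.coe_union, Finset.coe_filter, Set.mem_union,
      Set.mem_ofPred_eq, hmem]
    constructor
    · intro he
      rcases he.eq_or_eq_of_isLink (hth e he.edge_mem) with rfl | rfl
      exacts [Or.inl ⟨he.edge_mem, rfl⟩, Or.inr ⟨he.edge_mem, rfl⟩]
    · rintro (⟨he, rfl⟩ | ⟨he, rfl⟩)
      exacts [(hth e he).inc_left, (hth e he).inc_right]
  have h2 : G.loopSet x = ↑(E.filter (fun e => t e = x) ∩ E.filter (fun e => h e = x)) := by
    ext e
    simp only [mem_loopSet, Finset.coe_inter, Finset.coe_filter, Set.mem_inter_iff,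
      Set.mem_ofPred_eq, hmem]
    constructor
    · intro he
      have hl := hth e he.edge_mem
      exact ⟨⟨he.edge_mem, (he.eq_of_inc hl.inc_left).symm⟩,
        he.edge_mem, (he.eq_of_inc hl.inc_right).symm⟩
    · rintro ⟨⟨he, h1⟩, -, h2⟩
      have := hth e he
      rw [h1, h2] at this
      exact this
  rw [degree, h1, h2, Set.encard_coe_eq_coe_finsetCard, Set.encard_coe_eq_coe_finsetCard,
    ← Nat.cast_add, Finset.card_union_add_card_inter, Finset.card_filter, Finset.card_filter,
    ← Finset.sum_add_distrib, netSum]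

lemma IsCubic.even_order {G : Graph α β} (hG : G.IsCubic) : Even G.order := by
  rcases V(G).eq_empty_or_nonempty with h0 | hne
  · simp [order, h0]
  have : Nonempty α := hne.to_type
  obtain ⟨t, h, hth⟩ := G.exists_isEnds
  have hE := hG.edgeSet_finite.coe_toFinset
  have hV := hG.1.coe_toFinset
  have h1 := hth.sum_netSum hV hE (fun _ => 1)
  rw [Finset.sum_congr rfl fun x hx => show netSum _ t h (fun _ => (1 : ℕ)) x = 3 by
    have := hG.2 x (by simpa using hx)
    rw [hth.degree_eq hE] at this
    exact_mod_cast this] at h1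
  simp only [Finset.sum_const, smul_eq_mul] at h1
  rw [order, Set.ncard_eq_toFinset_card _ hG.1, Nat.even_iff]
  omega

lemma degree_mono {G H : Graph α β} (h : H ≤ G) (x : α) : H.degree x ≤ G.degree x :=
  add_le_add (Set.encard_le_encard fun _ he => Inc.mono h he)
    (Set.encard_le_encard fun _ he => IsLoopAt.mono h he)

lemma IsConnected.mem_of_adj_closed {G : Graph α β} (hG : G.IsConnected) {X : Set α} {x y : α}
    (hx : x ∈ V(G)) (hxX : x ∈ X) (hX : ∀ a b, a ∈ X → G.Adj a b → b ∈ X) (hy : y ∈ V(G)) :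
    y ∈ X := by
  induction hG.2 x hx y hy with
  | refl => exact hxX
  | tail hab h ih => exact hX _ _ (ih h.left_mem) h

end Degree

/-! ### Critical snarks are 6-irreducible -/

section Irreducible

theorem IsCritical.isIrreducible_six {G : Graph α β} (hG : G.IsSnark) (hcrit : G.IsCritical) :
    G.IsIrreducible 6 := by
  rintro S hSE hS C ⟨hCcl, hCconn⟩ hCcol ⟨H, hHC, hH, hlt⟩
  have hCV : V(C) ⊆ V(G) := fun x hx => by simpa using hCcl.vertexSet_mono hx
  have hle : C ≤ G := hCcl.le.trans deleteEdges_le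
  have hord : V(C).ncard ≤ H.order := by
    rw [← Set.ncard_image_of_injective _ (Sum.inl_injective (α := α) (β := ℕ))]
    refine Set.ncard_le_ncard ?_ hH.1
    rintro _ ⟨x, hx, rfl⟩
    exact hHC.1 x hx
  -- Both orders are even, so `H.order < G.order` means a difference of at least two.
  have hB : 1 < (V(G) \ V(C)).ncard := by
    rw [Set.ncard_sdiff hCV (hG.2.1.1.subset hCV)]
    have h1 := hH.even_order
    have h2 := hG.2.1.even_order
    rw [Nat.even_iff] at h1 h2
    unfold order at *
    omega
  obtain ⟨b₁, b₂, hb₁, hb₂, hb⟩ := (Set.one_lt_ncard_iff (hG.2.1.1.subset Set.sdiff_subset)).1 hB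
  -- If two adjacent vertices were both outside `C`, a colouring of `G` without them would colour
  -- `C`.
  have hind : ∀ e b x, b ∈ V(G) \ V(C) → G.IsLink e b x → b ≠ x → x ∈ V(C) := by
    intro e b x hbC hl hbx
    by_contra hx
    obtain ⟨h1, c, h2⟩ := (removeVerts_colourable_iff_proper _).1 (hcrit b x hbx hl.adj)
    have hout : ∀ y ∈ V(C), y ∉ ({b, x} : Set α) := by
      rintro y hy (rfl | rfl)
      exacts [hbC.2 hy, hx hy]
    exact hCcol ⟨fun e y he => h1 y (hout y he.vertex_mem) e (he.mono hle), c,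
      fun y e f he hf hef => h2 y (hout y he.vertex_mem) e f (he.mono hle) (hf.mono hle) hef⟩
  -- A vertex `b` with a loop has one other neighbour `a`, which lies in `C`. If `a` has a further
  -- neighbour `w`, the loop survives in `G - {a, w}`, contradicting criticality. Otherwise `a` has
  -- a loop too, and `a`, `b` are the only vertices, so just one is outside `C`.
  have hnoloop : ∀ b ∈ V(G) \ V(C), ∀ e, ¬ G.IsLoopAt e b := by
    intro b hb' l hl
    rcases degree_eq_three_cases (hG.2.1.2 b hb'.1) with ⟨-, -, -, -, -, -, -, hno⟩ |
      ⟨l', p, hlp, hl', hp, hinc⟩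
    · exact hno l hl
    obtain ⟨a, ha⟩ := (hinc p).2 (Or.inr rfl)
    have hba : b ≠ a := by rintro rfl; exact hp ha
    have haC := hind p b a hb' ha hba
    have hnb : ∀ y, G.Adj b y → y = b ∨ y = a := by
      rintro y ⟨e, he⟩
      rcases (hinc e).1 he.inc_left with rfl | rfl
      · exact Or.inl (he.right_unique hl')
      · exact Or.inr (he.right_unique ha)
    rcases degree_eq_three_cases (hG.2.1.2 a ha.right_mem) with
      ⟨q, r, s, hqr, hqs, hrs, hinca, hno⟩ | ⟨m, q, hmq, hm, hq, hinca⟩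
    · have : ∃ q, q ≠ p ∧ G.Inc q a := by
        by_cases hqp : q = p
        · exact ⟨r, fun h => hqr (hqp.trans h.symm), (hinca r).2 (by simp)⟩
        · exact ⟨q, hqp, (hinca q).2 (by simp)⟩
      obtain ⟨k, hkp, w, hk⟩ := this
      have haw : a ≠ w := by rintro rfl; exact hno k hk
      have hbw : b ≠ w := by
        rintro rfl
        rcases (hinc k).1 hk.inc_right with rfl | rfl
        · exact hba (hl'.eq_of_inc hk.inc_left)
        · exact hkp rfl
      refine ((removeVerts_colourable_iff_proper _).1 (hcrit a w haw hk.adj)).1 b ?_ l hl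
      rintro (h | h)
      exacts [hba h, hbw h]
    · have hna : ∀ y, G.Adj a y → y = a ∨ y = b := by
        rintro y ⟨e, he⟩
        rcases (hinca e).1 he.inc_left with rfl | rfl
        · exact Or.inl (he.right_unique hm)
        · rcases (hinca p).1 ha.inc_right with rfl | rfl
          · exact absurd (hm.eq_of_inc ha.inc_left).symm hba
          · exact Or.inr (he.right_unique ha.symm)
      have hall : ∀ y ∈ V(G), y ∈ ({a, b} : Set α) := fun y hy =>
        hG.1.mem_of_adj_closed hb'.1 (by simp) (by
          rintro x y (rfl | rfl) hxy
          · exact hna y hxy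
          · exact (hnb y hxy).symm) hy
      have hbb : ∀ y ∈ V(G) \ V(C), y = b := by
        intro y hy
        rcases hall y hy.1 with rfl | rfl
        · exact absurd haC hy.2
        · rfl
      exact hb ((hbb _ hb₁).trans (hbb _ hb₂).symm)
  -- The other end of an edge at `b` is in `C`; had the edge not been removed, the component `C`
  -- would contain `b`.
  have hsub : ∀ b ∈ V(G) \ V(C), G.incidenceSet b ⊆ S := by
    rintro b hb' e ⟨x, he⟩
    by_contra heS
    have hbx : b ≠ x := by rintro rfl; exact hnoloop b hb' e he
    have hx := hind e b x hb' he hbx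
    have h1 := hCcl.closed (show (G.deleteEdges S).Inc e x by
      rw [deleteEdges_inc]; exact ⟨he.inc_right, heS⟩) hx
    exact hb'.2 (((hle.isLink_iff h1).2 he).left_mem)
  have hcard : ∀ b ∈ V(G) \ V(C), (G.incidenceSet b).encard = 3 := by
    intro b hb'
    have := hG.2.1.2 b hb'.1
    rwa [degree, show G.loopSet b = ∅ from Set.eq_empty_of_forall_notMem (hnoloop b hb'),
      Set.encard_empty, add_zero] at this
  have hdisj : Disjoint (G.incidenceSet b₁) (G.incidenceSet b₂) := by
    rw [Set.disjoint_left]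
    rintro e ⟨x, he⟩ h2
    have hx : b₂ = x := h2.eq_of_isLink_of_ne_left he hb.symm
    exact hb₂.2 (hx ▸ hind e b₁ x hb₁ he (hx ▸ hb))
  have h6 := Set.encard_le_encard (Set.union_subset (hsub b₁ hb₁) (hsub b₂ hb₂))
  rw [Set.encard_union_eq hdisj, hcard b₁ hb₁, hcard b₂ hb₂] at h6
  have : (3 : ℕ∞) + 3 = ((6 : ℕ) : ℕ∞) := by norm_num
  rw [this] at h6
  exact absurd hS (not_lt.2 h6)

lemma IsIrreducible.mono {G : Graph α β} {k l : ℕ} (hkl : k ≤ l) (h : G.IsIrreducible l) :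
    G.IsIrreducible k :=
  fun S hSE hS => h S hSE (hS.trans_le (by exact_mod_cast hkl))

end Irreducible

/-! ### Completing subcubic graphs to cubic graphs -/

section Completion

/-- The graph with vertex set `W` and edge set `E` in which the edge `e` has the ends `t e` and
`h e`. -/
def ofEnds (W : Set α) (E : Set β) (t h : β → α) (ht : ∀ e ∈ E, t e ∈ W) (hh : ∀ e ∈ E, h e ∈ W) :
    Graph α β where
  vertexSet := W
  edgeSet := E
  IsLink e x y := e ∈ E ∧ (t e = x ∧ h e = y ∨ t e = y ∧ h e = x)
  isLink_symm := by
    rintro e -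
    exact ⟨fun x y h => ⟨h.1, h.2.symm⟩⟩
  eq_or_eq_of_isLink_of_isLink := by
    rintro e x y v w ⟨-, ⟨rfl, rfl⟩ | ⟨rfl, rfl⟩⟩ ⟨-, ⟨rfl, rfl⟩ | ⟨rfl, rfl⟩⟩ <;> simp
  edge_mem_iff_exists_isLink e :=
    ⟨fun he => ⟨_, _, he, Or.inl ⟨rfl, rfl⟩⟩, fun ⟨_, _, he, _⟩ => he⟩
  left_mem_of_isLink := by
    rintro e x y ⟨he, ⟨rfl, rfl⟩ | ⟨rfl, rfl⟩⟩
    exacts [ht e he, hh e he]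

open Classical in
/-- There is a finite sequence in which each `x ∈ W` occurs `d x` times. -/
lemma exists_sequence {γ : Type*} [Nonempty γ] (d : γ → ℕ) (W : Finset γ) : ∃ g : ℕ → γ,
    ∀ x, ∑ i ∈ Finset.range (∑ y ∈ W, d y), (if g i = x then 1 else 0) =
      if x ∈ W then d x else 0 := by
  induction W using Finset.induction_on with
  | empty => exact ⟨fun _ => Classical.arbitrary γ, fun x => by simp⟩
  | insert a W ha ih =>
    obtain ⟨g, hg⟩ := ih
    refine ⟨fun i => if i < ∑ y ∈ W, d y then g i else a, fun x => ?_⟩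
    rw [Finset.sum_insert ha, add_comm, Finset.sum_range_add]
    have h1 : ∀ i ∈ Finset.range (∑ y ∈ W, d y),
        (if (if i < ∑ y ∈ W, d y then g i else a) = x then 1 else 0) =
          if g i = x then 1 else 0 := fun i hi => by rw [if_pos (Finset.mem_range.1 hi)]
    rw [Finset.sum_congr rfl h1, hg]
    simp only [not_lt.2 (Nat.le_add_right _ _), if_false, Finset.sum_const, Finset.card_range,
      smul_eq_mul, Finset.mem_insert]
    by_cases hxa : x = a
    · subst hxa; simp [ha]
    · simp [hxa, Ne.symm hxa]

lemma sum_range_two_mul (f : ℕ → ℕ) (m : ℕ) :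
    ∑ i ∈ Finset.range (2 * m), f i = ∑ i ∈ Finset.range m, (f (2 * i) + f (2 * i + 1)) := by
  induction m with
  | zero => rfl
  | succ m ih => rw [mul_add, mul_one, Finset.sum_range_succ, Finset.sum_range_succ, ih,
      Finset.sum_range_succ, add_assoc]

/-- A finite graph with maximum degree at most three can be completed to a cubic graph by adding
edges and at most one vertex. -/
lemma exists_cubic_completion {C : Graph α β} (hV : V(C).Finite) (hE : E(C).Finite)
    (hne : V(C).Nonempty) (hdeg : ∀ x ∈ V(C), C.degree x ≤ 3) :
    ∃ H : Graph (α ⊕ ℕ) (β ⊕ ℕ), H.Completes C ∧ H.IsCubic ∧ H.order ≤ C.order + 1 := by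
  classical
  have : Nonempty α := hne.to_type
  obtain ⟨t, h, hth⟩ := C.exists_isEnds
  set E := hE.toFinset with hEdef
  have hEc : ↑E = E(C) := hE.coe_toFinset
  have hVc : (↑hV.toFinset : Set α) = V(C) := hV.coe_toFinset
  set deg : α ⊕ ℕ → ℕ := Sum.elim (netSum E t h fun _ => 1) 0 with hdegdef
  -- One extra vertex is added exactly when the order of `C` is odd. Then `|W|` is even, and so is
  -- the total deficiency `3|W| - 2|E|`.
  obtain ⟨W, hW1, hW2, hW3, hW4⟩ : ∃ W : Finset (α ⊕ ℕ), hV.toFinset.map .inl ⊆ W ∧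
      (∀ x, Sum.inl x ∈ W → x ∈ V(C)) ∧ Even W.card ∧ W.card ≤ V(C).ncard + 1 := by
    have hc : (hV.toFinset.map (.inl : α ↪ α ⊕ ℕ)).card = V(C).ncard := by
      rw [Finset.card_map, Set.ncard_eq_toFinset_card _ hV]
    by_cases hev : Even V(C).ncard
    · exact ⟨_, subset_rfl, fun x hx => by simpa using hx, hc ▸ hev, by omega⟩
    · have hn : (Sum.inr 0 : α ⊕ ℕ) ∉ hV.toFinset.map .inl := by simp
      refine ⟨insert (Sum.inr 0) (hV.toFinset.map .inl), Finset.subset_insert _ _,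
        fun x hx => by simpa using hx, ?_, ?_⟩
      · rw [Finset.card_insert_of_notMem hn, hc]
        exact (Nat.not_even_iff_odd.1 hev).add_one
      · rw [Finset.card_insert_of_notMem hn, hc]
  have hmemV : ∀ x ∈ V(C), (Sum.inl x : α ⊕ ℕ) ∈ W := fun x hx => hW1 (by simpa using hx)
  have hdeg3 : ∀ x ∈ W, deg x ≤ 3 := by
    rintro (x | n) hx
    · have := hdeg x (hW2 x hx)
      rw [hth.degree_eq hEc] at this
      exact_mod_cast this
    · simp [hdegdef]
  -- Every vertex is listed as often as its degree falls short of three. The new edge `i` joins the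
  -- entries `2i` and `2i + 1`; loops and parallel edges are harmless.
  obtain ⟨g, hg⟩ := exists_sequence (fun x => 3 - deg x) W
  have hsumdeg : ∑ x ∈ W, deg x = 2 * E.card := by
    rw [← Finset.sum_subset hW1, Finset.sum_map]
    · have := hth.sum_netSum hVc hEc (fun _ => 1)
      simp only [Finset.sum_const, smul_eq_mul] at this
      rw [mul_comm, ← this]
      rfl
    · rintro (x | n) hx hx'
      · exact absurd (by simpa using hW2 x hx) hx'
      · rfl
  obtain ⟨m, hm⟩ : ∃ m, ∑ x ∈ W, (3 - deg x) = 2 * m := by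
    have h1 : ∑ x ∈ W, (3 - deg x) + ∑ x ∈ W, deg x = 3 * W.card := by
      rw [← Finset.sum_add_distrib, Finset.sum_congr rfl fun x hx =>
        Nat.sub_add_cancel (hdeg3 x hx)]
      simp [mul_comm]
    obtain ⟨k, hk⟩ := hW3
    exact ⟨3 * k - E.card, by omega⟩
  simp only [hm] at hg
  have hgW : ∀ i < 2 * m, g i ∈ W := by
    intro i hi
    by_contra hiW
    have := hg (g i)
    rw [if_neg hiW, Finset.sum_eq_zero_iff] at this
    simpa using this i (Finset.mem_range.2 hi)
  set E' : Finset (β ⊕ ℕ) := E.disjSum (Finset.range m) with hE'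
  set t' : β ⊕ ℕ → α ⊕ ℕ := Sum.elim (fun e => Sum.inl (t e)) fun i => g (2 * i) with ht'
  set h' : β ⊕ ℕ → α ⊕ ℕ := Sum.elim (fun e => Sum.inl (h e)) fun i => g (2 * i + 1) with hh'
  have hEmem : ∀ e, e ∈ E ↔ e ∈ E(C) := fun e => by rw [← Finset.mem_coe, hEc]
  have htW : ∀ e ∈ (E' : Set (β ⊕ ℕ)), t' e ∈ (W : Set (α ⊕ ℕ)) := by
    rintro (e | i) he
    · rw [Finset.mem_coe, hE', Finset.inl_mem_disjSum, hEmem] at he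
      exact hmemV _ (hth e he).left_mem
    · rw [Finset.mem_coe, hE', Finset.inr_mem_disjSum, Finset.mem_range] at he
      exact hgW _ (by omega)
  have hhW : ∀ e ∈ (E' : Set (β ⊕ ℕ)), h' e ∈ (W : Set (α ⊕ ℕ)) := by
    rintro (e | i) he
    · rw [Finset.mem_coe, hE', Finset.inl_mem_disjSum, hEmem] at he
      exact hmemV _ (hth e he).right_mem
    · rw [Finset.mem_coe, hE', Finset.inr_mem_disjSum, Finset.mem_range] at he
      exact hgW _ (by omega)
  have hends : (ofEnds (W : Set (α ⊕ ℕ)) E' t' h' htW hhW).IsEnds t' h' :=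
    fun e he => ⟨he, Or.inl ⟨rfl, rfl⟩⟩
  refine ⟨ofEnds W E' t' h' htW hhW, ⟨fun x hx => hmemV x hx, fun e x y he => ?_⟩,
    ⟨W.finite_toSet, fun x hx => ?_⟩, ?_⟩
  · refine ⟨?_, ?_⟩
    · rw [Finset.mem_coe, hE', Finset.inl_mem_disjSum, hEmem]
      exact he.edge_mem
    · simp only [ht', hh', Sum.elim_inl, Sum.inl.injEq]
      exact (hth e he.edge_mem).eq_and_eq_or_eq_and_eq he
  · replace hx : x ∈ W := hx
    rw [hends.degree_eq rfl]
    have h1 : netSum E' t' h' (fun _ => 1) x = deg x + (3 - deg x) := by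
      have h2 := hg x
      rw [if_pos hx, sum_range_two_mul] at h2
      rw [netSum, hE', Finset.sum_disjSum, ← h2]
      congr 1
      rcases x with x | n
      · simp [ht', hh', hdegdef, netSum]
      · simp [ht', hh', hdegdef]
    rw [h1, Nat.add_sub_cancel' (hdeg3 x hx)]
    rfl
  · change (W : Set (α ⊕ ℕ)).ncard ≤ _
    rwa [Set.ncard_coe_finset]

end Completion

/-! ### Extending colourings at a vertex; colouring by components -/

section Extension

/-- A loopless vertex of degree three meets as many edges as there are colours, so an injective
partial colouring of these edges extends to a bijection. -/
lemma exists_injOn_extension {G : Graph α β} {x : α} (hx : G.degree x = 3)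
    (hl : ∀ e, ¬ G.IsLoopAt e x) {J : Set β} {c : β → Fin 3}
    (hc : ∀ e f, G.Inc e x → G.Inc f x → e ∈ J → f ∈ J → e ≠ f → c e ≠ c f) :
    ∃ g : β → Fin 3, (∀ e f, G.Inc e x → G.Inc f x → e ≠ f → g e ≠ g f) ∧
      ∀ e, G.Inc e x → e ∈ J → g e = c e := by
  classical
  rcases degree_eq_three_cases hx with ⟨p, q, r, hpq, hpr, hqr, hinc, -⟩ | ⟨l, -, -, hl', -⟩
  swap
  · exact absurd hl' (hl l)
  set I : Finset β := {p, q, r} with hI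
  have hmem : ∀ e, e ∈ I ↔ G.Inc e x := fun e => by simp [hI, hinc]
  have hcard : Fintype.card I = (Finset.univ : Finset (Fin 3)).card := by
    rw [Fintype.card_coe, hI, Finset.card_insert_of_notMem (by simp [hpq, hpr]),
      Finset.card_pair hqr]
    rfl
  obtain ⟨g, hg⟩ := Set.MapsTo.exists_equiv_extend_of_card_eq hcard
    (s := {e : I | (e : β) ∈ J}) (f := fun e => c e) (fun _ _ => by simp) (by
      intro e he f hf hef
      by_contra hne
      exact hc e f ((hmem e).1 e.2) ((hmem f).1 f.2) he hf (fun h => hne (Subtype.ext h)) hef)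
  refine ⟨fun e => if he : e ∈ I then g ⟨e, he⟩ else 0, fun e f he hf hef h => ?_,
    fun e he heJ => ?_⟩
  · beta_reduce at h
    rw [dif_pos ((hmem e).2 he), dif_pos ((hmem f).2 hf)] at h
    exact hef (congrArg Subtype.val (g.injective (Subtype.ext h)))
  · beta_reduce
    rw [dif_pos ((hmem e).2 he)]
    exact hg ⟨e, (hmem e).2 he⟩ heJ

lemma reflTransGen_adj_symm {G : Graph α β} {x y : α} (h : Relation.ReflTransGen G.Adj x y) :
    Relation.ReflTransGen G.Adj y x := by
  induction h with
  | refl => exact .refl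
  | tail _ h ih => exact .head h.symm ih

/-- The component of `x`. -/
def componentAt (G : Graph α β) (x : α) : Graph α β :=
  G.induce {y | Relation.ReflTransGen G.Adj x y}

lemma componentAt_eq {G : Graph α β} {x y : α} (h : Relation.ReflTransGen G.Adj x y) :
    G.componentAt x = G.componentAt y := by
  unfold componentAt
  congr 1
  ext z
  exact ⟨fun hz => (reflTransGen_adj_symm h).trans hz, fun hz => h.trans hz⟩

lemma componentAt_isComponentOf {G : Graph α β} {x : α} (hx : x ∈ V(G)) :
    (G.componentAt x).IsComponentOf G := by
  have hsub : {y | Relation.ReflTransGen G.Adj x y} ⊆ V(G) := by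
    intro y hy
    rcases Relation.ReflTransGen.cases_tail hy with rfl | ⟨z, -, hz⟩
    exacts [hx, hz.right_mem]
  have hle : G.componentAt x ≤ G := induce_le hsub
  have hpath : ∀ y, Relation.ReflTransGen G.Adj x y →
      Relation.ReflTransGen (G.componentAt x).Adj x y := by
    intro y hy
    induction hy with
    | refl => exact .refl
    | tail hab h ih =>
      obtain ⟨e, he⟩ := h
      exact ih.tail ⟨e, he, hab, hab.tail ⟨e, he⟩⟩
  refine ⟨IsClosedSubgraph.mk' hle ?_, ⟨x, .refl⟩, fun y hy z hz => ?_⟩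
  · rintro e y ⟨z, he⟩ hy
    exact ⟨y, z, he, hy, Relation.ReflTransGen.tail hy ⟨e, he⟩⟩
  · exact (reflTransGen_adj_symm (hpath y hy)).trans (hpath z hz)

/-- Components can be coloured separately. -/
lemma exists_colouring_of_components {G : Graph α β} {X : Set α}
    (hX : ∀ x ∈ V(G), x ∉ X → (G.componentAt x).IsThreeEdgeColourable) :
    (∀ x ∉ X, ∀ e, ¬ G.IsLoopAt e x) ∧
      ∃ c : β → Fin 3, ∀ x ∉ X, ∀ e f, G.Inc e x → G.Inc f x → e ≠ f → c e ≠ c f := by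
  classical
  have hcl : ∀ {x e}, G.Inc e x → (G.componentAt x).Inc e x := fun ⟨y, hy⟩ =>
    ⟨y, hy, .refl, .single ⟨_, hy⟩⟩
  refine ⟨fun x hx e he => (hX x he.vertex_mem hx).1 e x ⟨he, .refl, .refl⟩, ?_⟩
  set d : Graph α β → β → Fin 3 := fun C =>
    if hC : C.IsThreeEdgeColourable then hC.2.choose else fun _ => 0 with hd
  set c : β → Fin 3 := fun e => if he : ∃ x, G.Inc e x then d (G.componentAt he.choose) e else 0
    with hc
  -- Both ends of an edge have the same component, hence the same chosen colouring, so it does not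
  -- matter which end is picked.
  have hcd : ∀ {x e}, G.Inc e x → c e = d (G.componentAt x) e := by
    intro x e he
    have hex : ∃ x, G.Inc e x := ⟨x, he⟩
    simp only [hc]
    rw [dif_pos hex]
    congr 1
    apply componentAt_eq
    obtain ⟨y, hy⟩ := hex.choose_spec
    rcases he.eq_or_eq_of_isLink hy with h | h
    · rw [← h]
    · rw [h]; exact .single ⟨e, hy⟩
  refine ⟨c, fun x hx e f he hf hef => ?_⟩
  have hC := hX x he.vertex_mem hx
  rw [hcd he, hcd hf]
  simp only [hd]
  rw [dif_pos hC]
  exact hC.2.choose_spec x e f (hcl he) (hcl hf) hef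

end Extension

/-! ### 5-irreducible snarks are critical -/

section Irreducible

theorem IsIrreducible.isCritical {G : Graph α β} (hG : G.IsSnark) (hirr : G.IsIrreducible 5) :
    G.IsCritical := by
  classical
  rintro u v huv ⟨e₀, he₀⟩
  set X : Set α := {u, v} with hX
  set S : Set β := {e | ∃ x y, G.IsLink e x y ∧ x ∉ X ∧ y ∈ X} with hS
  have hSE : S ⊆ E(G) := by
    rintro e ⟨x, y, h, -⟩
    exact h.edge_mem
  have hinc : ∀ w ∈ V(G), G.Inc e₀ w → (G.incidenceSet w \ {e₀}).encard ≤ 2 := by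
    intro w hw hew
    have h1 : (G.incidenceSet w).encard ≤ 3 := by
      rw [← hG.2.1.2 w hw, degree]
      exact le_self_add
    rw [← Set.encard_sdiff_singleton_add_one (show e₀ ∈ G.incidenceSet w from hew)] at h1
    exact (ENat.add_le_add_iff_right ENat.one_ne_top).1 (h1.trans_eq (by norm_num))
  -- Besides `e₀`, at most two edges meet each of `u` and `v`.
  have hS5 : S.encard < (5 : ℕ) := by
    have hsub : S ⊆ (G.incidenceSet u \ {e₀}) ∪ (G.incidenceSet v \ {e₀}) := by
      rintro e ⟨x, y, h, hx, hy⟩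
      have hne : e ∉ ({e₀} : Set β) := by
        rintro rfl
        exact hx (h.inc_left.eq_or_eq_of_isLink he₀)
      rcases hy with rfl | rfl
      exacts [Or.inl ⟨h.inc_right, hne⟩, Or.inr ⟨h.inc_right, hne⟩]
    calc S.encard ≤ 2 + 2 := (Set.encard_le_encard hsub).trans ((Set.encard_union_le _ _).trans
          (add_le_add (hinc u he₀.left_mem he₀.inc_left) (hinc v he₀.right_mem he₀.inc_right)))
      _ < (5 : ℕ) := by norm_num
  have hcomp : ∀ x ∈ V(G.deleteEdges S), x ∉ X →
      ((G.deleteEdges S).componentAt x).IsThreeEdgeColourable := by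
    intro x hx hxX
    by_contra hcol
    have hC := componentAt_isComponentOf hx
    set C := (G.deleteEdges S).componentAt x with hCdef
    refine hirr S hSE hS5 C hC hcol ?_
    have hle : C ≤ G := hC.1.le.trans deleteEdges_le
    have hfin : V(C).Finite := hG.2.1.1.subset hle.vertexSet_mono
    obtain ⟨H, h1, h2, h3⟩ := exists_cubic_completion hfin
      (hG.2.1.edgeSet_finite.subset hle.edgeSet_mono) hC.2.1
      (fun y hy => (degree_mono hle y).trans (hG.2.1.2 y (hle.vertexSet_mono hy)).le)
    refine ⟨H, h1, h2, h3.trans_lt ?_⟩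
    -- The component avoids both `u` and `v`, so even with the extra vertex its completion has order
    -- below that of `G`.
    have hout : V(C) ⊆ V(G) \ X := by
      have hreach : ∀ y, Relation.ReflTransGen (G.deleteEdges S).Adj x y → y ∉ X := by
        intro y hy
        induction hy with
        | refl => exact hxX
        | tail _ h ih =>
          obtain ⟨e, he⟩ := h
          rw [deleteEdges_isLink] at he
          exact fun hcX => he.2 ⟨_, _, he.1, ih, hcX⟩
      exact fun y hy => ⟨hle.vertexSet_mono hy, hreach y hy⟩
    have hXV : X ⊆ V(G) := by
      rintro w (rfl | rfl)
      exacts [he₀.left_mem, he₀.right_mem]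
    have h4 := Set.ncard_le_ncard hout (hG.2.1.1.subset Set.sdiff_subset)
    rw [Set.ncard_sdiff hXV (hG.2.1.1.subset hXV), hX, Set.ncard_pair huv] at h4
    have h5 := Set.ncard_le_ncard hXV hG.2.1.1
    rw [hX, Set.ncard_pair huv] at h5
    unfold order
    omega
  obtain ⟨hl, c, hc⟩ := exists_colouring_of_components hcomp
  have hl' : ∀ x ∉ X, ∀ e, ¬ G.IsLoopAt e x := by
    intro x hx e he
    refine hl x hx e ?_
    rw [deleteEdges_isLoopAt]
    refine ⟨he, ?_⟩
    rintro ⟨y, z, h, hy, hz⟩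
    exact hx (he.eq_of_inc h.inc_right ▸ hz)
  have hext : ∀ x, ∃ g : β → Fin 3, x ∈ V(G) → x ∉ X →
      (∀ e f, G.Inc e x → G.Inc f x → e ≠ f → g e ≠ g f) ∧
      ∀ e, G.Inc e x → e ∈ Sᶜ → g e = c e := by
    intro x
    by_cases hx : x ∈ V(G) ∧ x ∉ X
    · obtain ⟨g, hg⟩ := exists_injOn_extension (hG.2.1.2 x hx.1) (hl' x hx.2) (J := Sᶜ) (c := c)
        (fun e f he hf heS hfS hef => hc x hx.2 e f (by rw [deleteEdges_inc]; exact ⟨he, heS⟩)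
          (by rw [deleteEdges_inc]; exact ⟨hf, hfS⟩) hef)
      exact ⟨g, fun _ _ => hg⟩
    · exact ⟨fun _ => 0, fun h1 h2 => absurd ⟨h1, h2⟩ hx⟩
  choose g hg using hext
  rw [removeVerts_colourable_iff_proper]
  -- An edge of `S` has only one end outside `X`, so the local extensions at different vertices
  -- cannot conflict.
  set c' : β → Fin 3 := fun e => if he : e ∈ S then g he.choose e else c e with hc'
  have hcg : ∀ x ∉ X, ∀ e, G.Inc e x → c' e = g x e := by
    intro x hx e he
    by_cases heS : e ∈ S
    · simp only [hc']
      rw [dif_pos heS]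
      obtain ⟨y, hy, -, hyX⟩ := heS.choose_spec
      rcases he.eq_or_eq_of_isLink hy with h | h
      · rw [← h]
      · exact absurd (h ▸ hyX) hx
    · simp only [hc']
      rw [dif_neg heS, (hg x he.vertex_mem hx).2 e he heS]
  refine ⟨hl', c', fun x hx e f he hf hef => ?_⟩
  rw [hcg x hx e he, hcg x hx f hf]
  exact (hg x he.vertex_mem hx).1 e f he hf hef

end Irreducible

end Graph

theorem mainTheorem2 {α β : Type*} (G : Graph α β) (hG : G.IsSnark) :
    List.TFAE
      [G.IsCritical,
       G.IsEdgeCritical 4,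
       G.IsIrreducible 5,
       G.IsIrreducible 6,
       ∀ e ∈ E(G), (∀ x, ¬ G.IsLoopAt e x) → (G.deleteSuppress e).IsThreeEdgeColourable] := by
  tfae_have 1 ↔ 2 := Graph.isCritical_iff_isEdgeCritical hG
  tfae_have 1 ↔ 5 := Graph.isCritical_iff_deleteSuppress hG
  tfae_have 1 → 4 := Graph.IsCritical.isIrreducible_six hG
  tfae_have 4 → 3 := Graph.IsIrreducible.mono (by norm_num)
  tfae_have 3 → 1 := Graph.IsIrreducible.isCritical hG
  tfae_finish
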